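/- Let $\mathcal M_{\mathbb Q,2}$ be the moduli space of semi-stable $\mathbb Z$-lattices $\Lambda$ of rank two (full lattices in the Euclidean plane, up to isometry), where $\Lambda$ is semi-stable if every sublattice $\Lambda_1$ of rank one (with torsion-free quotient $\Lambda/\Lambda_1$) satisfies $\mathrm{Vol}(\Lambda_1)^2\ge \mathrm{Vol}(\Lambda)$; here the volume of a rank one lattice is the length of a generator and that of a rank two lattice is the area of a fundamental parallelogram. Put $h^0(\mathbb Q,\Lambda)=\log\sum_{x\in\Lambda}e^{-\pi\|x\|^2}$. Let $d\mu$ be the measure $\frac{dx\,dy}{y^2}\cdot\frac{dt}{t}$ on the space of lattices, where the point $\tau=x+iy$ of the standard fundamental domain of $SL_2(\mathbb Z)$ and $t>0$ correspond to the lattice $\sqrt{t/y}\,(\mathbb Z+\mathbb Z\tau)$, of volume $t$. The rank two non-abelian zeta function of $\mathbb Q$ is $$\xi_{\mathbb Q,2}(s)=\int_{\mathcal M_{\mathbb Q,2}}\bigl(e^{h^0(\mathbb Q,\Lambda)}-1\bigr)\,\mathrm{Vol}(\Lambda)^{s}\,d\mu(\Lambda),\qquad \mathrm{Re}(s)>1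 .$$ Then this integral converges absolutely for $\mathrm{Re}(s)>1$, it has a meromorphic continuation $\xi_{\mathbb Q,2}$ to $\mathbb C$, and all zeros of $\xi_{\mathbb Q,2}(s)$ lie on the line $\mathrm{Re}(s)=\frac12$. -/

import Mathlib

open MeasureTheory UpperHalfPlane
open scoped ENNReal

noncomputable section

namespace NonabelianZeta

/-- A rank two `ℤ`-lattice, i.e. a free `ℤ`-module of rank two with a Euclidean inner product on
its real span, realised as a full lattice in the Euclidean plane `ℂ`. -/
structure Lattice where
  carrier : Submodule ℤ ℂ
  discrete : DiscreteTopology carrier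
  isZLattice : IsZLattice ℝ carrier

namespace Lattice

/-- Two lattices are isometric if some linear isometry of the plane takes one onto the other. -/
def Isometric (L M : Lattice) : Prop :=
  ∃ u : ℂ ≃ₗᵢ[ℝ] ℂ, ∀ x : ℂ, x ∈ L.carrier ↔ u x ∈ M.carrier

theorem Isometric.symm {L M : Lattice} (h : Isometric L M) : Isometric M L := by
  obtain ⟨u, hu⟩ := h
  exact ⟨u.symm, fun x => by rw [hu, u.apply_symm_apply]⟩

instance isometrySetoid : Setoid Lattice where
  r := Isometric
  iseqv :=
    { refl := fun _ => ⟨LinearIsometryEquiv.refl ℝ ℂ, fun _ => Iff.rfl⟩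
      symm := Isometric.symm
      trans := by
        rintro L M N ⟨u, hu⟩ ⟨v, hv⟩
        exact ⟨u.trans v, fun x => (hu x).trans (hv (u x))⟩ }

/-- The volume of a lattice: the area of a fundamental parallelogram. -/
def vol (L : Lattice) : ℝ := ZLattice.covolume L.carrier

/-- The geo-arithmetical cohomology `h⁰(Λ) = log ∑_{x ∈ Λ} exp (-π ‖x‖²)`. -/
def h0 (L : Lattice) : ℝ :=
  Real.log (∑' x : L.carrier, Real.exp (-Real.pi * ‖(x : ℂ)‖ ^ 2))

/-- Semi-stability: `Vol(Λ₁)^{rk Λ} ≥ Vol(Λ)^{rk Λ₁}` for every proper sublattice `Λ₁`, that is, for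
every submodule `Λ₁` of smaller rank with torsion-free quotient. For `Λ` of rank two the condition
is void in rank zero, and a rank one sublattice is `ℤ v` with `v ≠ 0`, whose volume is the length
of its generator `v`. -/
def IsSemistable (L : Lattice) : Prop :=
  ∀ v ∈ L.carrier, v ≠ 0 →
    (∀ x ∈ L.carrier, ∀ n : ℤ, n ≠ 0 → n • x ∈ Submodule.span ℤ {v} →
      x ∈ Submodule.span ℤ {v}) →
    L.vol ≤ ‖v‖ ^ 2

theorem vol_congr {L M : Lattice} (h : Isometric L M) : L.vol = M.vol := by
  obtain ⟨u, hu⟩ := h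
  have := M.discrete
  have := M.isZLattice
  have hc : L.carrier = ZLattice.comap ℝ M.carrier
      (u.toContinuousLinearEquiv.toLinearEquiv : ℂ →ₗ[ℝ] ℂ) := by
    ext x
    exact hu x
  unfold vol
  rw [hc]
  exact ZLattice.covolume_comap (e := u.toContinuousLinearEquiv) M.carrier volume volume
    u.measurePreserving

theorem h0_congr {L M : Lattice} (h : Isometric L M) : L.h0 = M.h0 := by
  obtain ⟨u, hu⟩ := h
  let e : L.carrier ≃ M.carrier := u.toEquiv.subtypeEquiv hu
  unfold h0
  congr 1
  rw [← e.tsum_eq]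
  refine tsum_congr fun x => ?_
  have : ((e x : M.carrier) : ℂ) = u x := rfl
  rw [this, u.norm_map]

theorem IsSemistable.congr {L M : Lattice} (h : Isometric L M) (hL : L.IsSemistable) :
    M.IsSemistable := by
  have hvol := vol_congr h
  obtain ⟨u, hu⟩ := h
  have key : ∀ x w : ℂ, x ∈ Submodule.span ℤ {w} ↔ u x ∈ Submodule.span ℤ {u w} := by
    intro x w
    simp only [Submodule.mem_span_singleton]
    refine exists_congr fun a => ?_
    rw [← map_zsmul u a w]
    exact u.injective.eq_iff.symm
  intro v hv hv0 hprim
  obtain ⟨w, rfl⟩ := u.surjective v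
  rw [← hvol, u.norm_map]
  refine hL w ((hu w).2 hv) (fun h0 => hv0 (by rw [h0, map_zero])) fun x hx n hn hnx => ?_
  rw [key] at hnx ⊢
  exact hprim (u x) ((hu x).1 hx) n hn (by rwa [map_zsmul] at hnx)

theorem isSemistable_congr {L M : Lattice} (h : Isometric L M) :
    L.IsSemistable ↔ M.IsSemistable :=
  ⟨IsSemistable.congr h, IsSemistable.congr h.symm⟩

theorem indep_normalized (τ : ℍ) (t : Set.Ioi (0 : ℝ)) :
    LinearIndependent ℝ ![((Real.sqrt (t / τ.im) : ℝ) : ℂ), (Real.sqrt (t / τ.im) : ℝ) * (τ : ℂ)] := by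
  have hc : 0 < Real.sqrt (t / τ.im) := Real.sqrt_pos.2 (div_pos t.2 τ.im_pos)
  rw [LinearIndependent.pair_iff]
  intro a b hab
  have him := congrArg Complex.im hab
  have hre := congrArg Complex.re hab
  simp at him hre
  have hb : b = 0 := by
    rcases him with h | h | h
    · exact h
    · exact absurd h hc.ne'
    · exact absurd h τ.im_pos.ne'
  subst hb
  simp at hre
  exact ⟨hre.resolve_right hc.ne', rfl⟩

/-- The lattice of volume `t` similar to the lattice generated by `1` and `τ`. -/
def ofPoint (p : ℍ × Set.Ioi (0 : ℝ)) : Lattice where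
  carrier := (PeriodPair.mk _ _ (indep_normalized p.1 p.2)).lattice
  discrete := inferInstance
  isZLattice := inferInstance

end Lattice

/-- The moduli space of rank two `ℤ`-lattices: isometry classes of lattices. -/
def Moduli : Type := Quotient Lattice.isometrySetoid

namespace Moduli

def vol : Moduli → ℝ := Quotient.lift Lattice.vol fun _ _ h => Lattice.vol_congr h

def h0 : Moduli → ℝ := Quotient.lift Lattice.h0 fun _ _ h => Lattice.h0_congr h

def IsSemistable : Moduli → Prop :=
  Quotient.lift Lattice.IsSemistable fun _ _ h => propext (Lattice.isSemistable_congr h)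

/-- The isometry class of the lattice of volume `t` similar to `ℤ + ℤ τ`. -/
def ofPoint (p : ℍ × Set.Ioi (0 : ℝ)) : Moduli := Quotient.mk _ (Lattice.ofPoint p)

/-- The quotient measurable structure. -/
instance : MeasurableSpace Moduli := MeasurableSpace.map ofPoint inferInstance

/-- The invariant measure `dt / t` on `(0, ∞)`. -/
def scaleMeasure : Measure (Set.Ioi (0 : ℝ)) :=
  (Measure.comap Subtype.val (volume : Measure ℝ)).withDensity fun t => ENNReal.ofReal (1 / t.1)

/-- The measure on the moduli space induced from the invariant measure of
`GL₂(ℝ) / O(2) ≃ ℍ × (0, ∞)`, which is `dx dy / y² × dt / t` (the `volume` of `ℍ` is `dx dy / y²`):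
its restriction to the standard fundamental domain of `SL₂(ℤ)`, pushed forward. -/
def measure : Measure Moduli :=
  Measure.map ofPoint (((volume : Measure ℍ).restrict ModularGroup.fd).prod scaleMeasure)

end Moduli

/-- The integrand `(e^{h⁰(Λ)} - 1) (e^{-s})^{-log Vol(Λ)}`. -/
def integrand (s : ℂ) (Λ : Moduli) : ℂ :=
  ((Real.exp Λ.h0 - 1 : ℝ) : ℂ) * Complex.exp (s * (Real.log Λ.vol : ℂ))

/-- The integral over the moduli space of semi-stable lattices that defines the rank two
non-abelian zeta function of `ℚ` for `Re s > 1`. -/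
def rankTwoZetaIntegral (s : ℂ) : ℂ :=
  ∫ Λ in {Λ : Moduli | Λ.IsSemistable}, integrand s Λ ∂Moduli.measure

/-- `ξ` is the rank two non-abelian zeta function `ξ_{ℚ,2}`: the meromorphic continuation to the
plane of the moduli integral. -/
structure IsRankTwoZeta (ξ : ℂ → ℂ) : Prop where
  meromorphic : Meromorphic ξ
  eq_integral : ∀ s : ℂ, 1 < s.re → ξ s = rankTwoZetaIntegral s

end NonabelianZeta

end

namespace NonabelianZeta

open Filter Topology Set

/-! For Re s > 1 the moduli integral equals 2Λ(2s)/(s-1) - 2Λ(2s-1)/s, where Λ is the completed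
Riemann zeta function. With the entire function xi(w) = w(w-1)Λ(w) this becomes (xi(2s) - xi(2s-1))
/ (s(s-1)(2s-1)), which is meromorphic on the plane.

The formula is first proved at real σ > 1, where all terms are nonnegative and Tonelli applies in
[0, ∞]. Integrating over the scale t turns the theta series into π^{-σ}Γ(σ) times an Epstein zeta
function (`lintegral_isSemistable_eq_epstein`). After ζ(2σ) is split off, the sum over primitive
vectors unfolds the fundamental domain to the strip |Re τ| ≤ 1/2 (`lintegral_fd_tsum_coprime`),
since semistability is invariant under the modular group. The semistable points of the strip are
those with Im τ ≤ 1 outside the pairwise disjoint Ford discs tangent to the real line at rational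
points (`indicator_im_le_one`). The region Im τ ≤ 1 contributes 1/(σ-1). The discs contribute ∑ φ(n)
n^{-2σ} = ζ(2σ-1)/ζ(2σ) times a beta value. The identity theorem extends the formula to complex s.

A zero forces xi(2s) = xi(2s-1). But |xi(z)| < |xi(z+1)| whenever Re z > 0 (`norm_xiRatio_lt_one`):
the quotient is holomorphic on Re z ≥ 0 because ζ has no zeros on Re ≥ 1, it has modulus one on the
imaginary axis by the functional equation, and it grows at most linearly, so Phragmén–Lindelöf
bounds it by one; it is not of constant modulus, as xi(1)/xi(2) = 3/π. Hence Re s ≤ 1/2, and s ↦ 1 -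
s gives the reverse inequality. -/

/-! ### Explicit bounds for ζ, 1/ζ and a quotient of Gamma factors -/

/-- The fractional part, cut off to the half line `t > 1`. -/
noncomputable def fractTail (t : ℝ) : ℂ := (Ioi (1 : ℝ)).indicator (fun t => ((Int.fract t : ℝ) : ℂ)) t

theorem measurable_fractTail : Measurable fractTail :=
  (Complex.measurable_ofReal.comp measurable_fract).indicator measurableSet_Ioi

theorem norm_fractTail_le (t : ℝ) : ‖fractTail t‖ ≤ (Ioi (1 : ℝ)).indicator 1 t := by
  by_cases h : t ∈ Ioi (1 : ℝ)
  · simp only [fractTail, indicator_of_mem h, Complex.norm_real, Real.norm_eq_abs,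
      abs_of_nonneg (Int.fract_nonneg t), Pi.one_apply]
    exact (Int.fract_lt_one t).le
  · simp [fractTail, indicator_of_notMem h]

theorem norm_fractTail_le_one (t : ℝ) : ‖fractTail t‖ ≤ 1 :=
  (norm_fractTail_le t).trans (indicator_le_self' (by simp) t)

theorem differentiableAt_mellin_fractTail {s : ℂ} (hs : s.re < 0) :
    DifferentiableAt ℂ (mellin fractTail) s := by
  -- `fractTail` vanishes near 0, so any exponent `b` below Re s serves there; at infinity
  -- boundedness and Re s < 0 suffice.
  refine mellin_differentiableAt_of_isBigO_rpow (a := 0) (b := s.re - 1) ?_ ?_ hs ?_ (by linarith)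
  · refine LocallyIntegrable.locallyIntegrableOn ?_ _
    refine (locallyIntegrable_const (1 : ℝ)).mono measurable_fractTail.aestronglyMeasurable ?_
    exact Eventually.of_forall fun t => by simpa using norm_fractTail_le_one t
  · refine Asymptotics.IsBigO.of_bound 1 (Eventually.of_forall fun t => ?_)
    simpa using norm_fractTail_le_one t
  · refine (Asymptotics.isBigO_zero _ _).congr' ?_ EventuallyEq.rfl
    filter_upwards [nhdsWithin_le_nhds (Iio_mem_nhds (zero_lt_one' ℝ))] with t ht
    have : t ∉ Ioi (1 : ℝ) := not_lt.2 (le_of_lt (mem_Iio.1 ht))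
    simp [fractTail, this]

theorem norm_mellin_fractTail_le {s : ℂ} (hs : s.re < 0) :
    ‖mellin fractTail s‖ ≤ 1 / (-s.re) := by
  have h1 : ∫ t in Ioi (1 : ℝ), t ^ (s.re - 1) = 1 / (-s.re) := by
    rw [integral_Ioi_rpow_of_lt (by linarith) one_pos]
    simp only [Real.one_rpow, sub_add_cancel]
    rw [neg_div, ← div_neg]
  have hint : IntegrableOn (fun t : ℝ => t ^ (s.re - 1)) (Ioi 1) :=
    integrableOn_Ioi_rpow_of_lt (by linarith) one_pos
  rw [← h1, mellin]
  calc ‖∫ t in Ioi (0 : ℝ), (t : ℂ) ^ (s - 1) • fractTail t‖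
      ≤ ∫ t in Ioi (0 : ℝ), (Ioi (1 : ℝ)).indicator (fun t => t ^ (s.re - 1)) t := by
        refine norm_integral_le_of_norm_le ?_ ?_
        · exact ((integrable_indicator_iff measurableSet_Ioi).2 hint).integrableOn
        · filter_upwards [ae_restrict_mem measurableSet_Ioi] with t ht
          rw [norm_smul, Complex.norm_cpow_eq_rpow_re_of_pos ht]
          refine (mul_le_mul_of_nonneg_left (norm_fractTail_le t)
            (Real.rpow_nonneg (le_of_lt ht) _)).trans (le_of_eq ?_)
          by_cases h : t ∈ Ioi (1 : ℝ) <;> simp [h]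
    _ = ∫ t in Ioi (1 : ℝ), t ^ (s.re - 1) := by
        rw [setIntegral_indicator measurableSet_Ioi]
        congr 2
        ext t
        simp only [mem_inter_iff, mem_Ioi]
        exact ⟨fun h => h.2, fun h => ⟨by linarith, h⟩⟩

/-- Abel summation gives ζ(z) = z ∫ ⌊t⌋ t^{-z-1} dt over t > 1. Splitting ⌊t⌋ into t minus its
fractional part isolates the pole. -/
theorem riemannZeta₁_eq_of_one_lt_re {z : ℂ} (hz : 1 < z.re) :
    riemannZeta₁ z = z - z * (z - 1) * mellin fractTail (-z) := by
  have hz1 : z ≠ 1 := by rintro rfl; simp at hz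
  have hz1' : z - 1 ≠ 0 := sub_ne_zero.2 hz1
  have h1 : riemannZeta₁ z = (z - 1) * riemannZeta z := by
    rw [riemannZeta_eq_inv_sub_mul hz1, mul_inv_cancel_left₀ hz1']
  have h2 := LSeries_eq_mul_integral_of_nonneg (fun _ => 1) zero_le_one hz (by
    refine Asymptotics.IsBigO.of_bound 1 (Eventually.of_forall fun n => ?_)
    simp) (fun _ => zero_le_one)
  have h3 : LSeries (fun n => (((fun _ : ℕ => (1 : ℝ)) n : ℝ) : ℂ)) z = riemannZeta z := by
    rw [← LSeries_one_eq_riemannZeta hz]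
    congr 1
  have hi1 : IntegrableOn (fun t : ℝ => (t : ℂ) ^ (-z)) (Ioi 1) :=
    integrableOn_Ioi_cpow_of_lt (by simpa using hz) one_pos
  have h5 : mellin fractTail (-z)
      = ∫ t in Ioi (1 : ℝ), ((Int.fract t : ℝ) : ℂ) * (t : ℂ) ^ (-(z + 1)) := by
    have h : ∀ t : ℝ, (t : ℂ) ^ (-z - 1) • fractTail t = (Ioi (1 : ℝ)).indicator
        (fun t : ℝ => ((Int.fract t : ℝ) : ℂ) * (t : ℂ) ^ (-(z + 1))) t := by
      intro t
      by_cases ht : t ∈ Ioi (1 : ℝ)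
      · rw [fractTail, indicator_of_mem ht, indicator_of_mem ht, smul_eq_mul, mul_comm, neg_add']
      · rw [fractTail, indicator_of_notMem ht, indicator_of_notMem ht, smul_zero]
    simp_rw [mellin, h]
    rw [setIntegral_indicator measurableSet_Ioi,
      inter_eq_right.2 (Ioi_subset_Ioi (zero_le_one' ℝ))]
  have hi2 : IntegrableOn (fun t : ℝ => ((Int.fract t : ℝ) : ℂ) * (t : ℂ) ^ (-(z + 1))) (Ioi 1) := by
    refine Integrable.bdd_mul (c := 1) ?_ ?_ ?_
    · exact integrableOn_Ioi_cpow_of_lt (by simp; linarith) one_pos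
    · exact (Complex.measurable_ofReal.comp measurable_fract).aestronglyMeasurable
    · refine Eventually.of_forall fun t => ?_
      simp only [Complex.norm_real, Real.norm_eq_abs, abs_of_nonneg (Int.fract_nonneg t)]
      exact (Int.fract_lt_one t).le
  have h6 : ∫ t in Ioi (1 : ℝ), (∑ k ∈ Finset.Icc 1 ⌊t⌋₊, (((1 : ℝ)) : ℂ)) * (t : ℂ) ^ (-(z + 1))
      = 1 / (z - 1) - mellin fractTail (-z) := by
    have h7 : ∫ t in Ioi (1 : ℝ), (t : ℂ) ^ (-z) = 1 / (z - 1) := by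
      rw [integral_Ioi_cpow_of_lt (by simpa using hz) one_pos]
      simp only [Complex.ofReal_one, Complex.one_cpow]
      rw [neg_div, ← div_neg]; congr 1; ring
    rw [h5, ← h7, ← integral_sub hi1 hi2]
    refine setIntegral_congr_fun measurableSet_Ioi fun t ht => ?_
    have ht0 : (0 : ℝ) < t := lt_trans one_pos ht
    have h8 : (t : ℂ) ^ (-z) = t * (t : ℂ) ^ (-(z + 1)) := by
      rw [neg_add, Complex.cpow_add _ _ (by exact_mod_cast ht0.ne'), Complex.cpow_neg_one]
      have : (t : ℂ) ≠ 0 := by exact_mod_cast ht0.ne'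
      rw [mul_comm, mul_assoc, inv_mul_cancel₀ this, mul_one]
    have h9 : ((⌊t⌋₊ : ℝ)) = t - Int.fract t := by
      rw [Int.self_sub_fract, natCast_floor_eq_intCast_floor ht0.le]
    have h10 : ((⌊t⌋₊ : ℂ)) = t - (Int.fract t : ℝ) := by
      rw [← Complex.ofReal_sub, ← h9]; simp
    simp only [Finset.sum_const, Nat.card_Icc, add_tsub_cancel_right, Complex.ofReal_one,
      nsmul_eq_mul, mul_one]
    rw [h8, h10]; ring
  rw [h1, ← h3, h2, h6]
  field_simp

theorem riemannZeta₁_eq {z : ℂ} (hz : 0 < z.re) :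
    riemannZeta₁ z = z - z * (z - 1) * mellin fractTail (-z) := by
  have hopen : IsOpen {z : ℂ | 0 < z.re} := isOpen_lt continuous_const Complex.continuous_re
  have hf : AnalyticOnNhd ℂ riemannZeta₁ {z : ℂ | 0 < z.re} :=
    differentiable_riemannZeta₁.differentiableOn.analyticOnNhd hopen
  have hg : AnalyticOnNhd ℂ (fun z : ℂ => z - z * (z - 1) * mellin fractTail (-z))
      {z : ℂ | 0 < z.re} := by
    refine DifferentiableOn.analyticOnNhd (fun w hw => ?_) hopen
    have : DifferentiableAt ℂ (fun z : ℂ => mellin fractTail (-z)) w :=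
      (differentiableAt_mellin_fractTail (s := -w) (by simpa using hw)).comp w
        differentiableAt_id.neg
    exact (by fun_prop : DifferentiableAt ℂ _ w).differentiableWithinAt
  refine hf.eqOn_of_preconnected_of_eventuallyEq hg
    (convex_halfSpace_re_gt 0).isPreconnected (by simp : (2 : ℂ) ∈ {z : ℂ | 0 < z.re}) ?_ hz
  filter_upwards [(isOpen_lt continuous_const Complex.continuous_re).mem_nhds
    (by simp : (1 : ℝ) < (2 : ℂ).re)] with w hw
  exact riemannZeta₁_eq_of_one_lt_re hw

theorem norm_riemannZeta₁_le {z : ℂ} (hz : 0 < z.re) :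
    ‖riemannZeta₁ z‖ ≤ ‖z‖ * (1 + ‖z - 1‖ / z.re) := by
  rw [riemannZeta₁_eq hz]
  have h := norm_mellin_fractTail_le (s := -z) (by simpa using hz)
  simp only [Complex.neg_re, neg_neg] at h
  calc _ ≤ ‖z‖ + ‖z‖ * ‖z - 1‖ * ‖mellin fractTail (-z)‖ := by
        refine (norm_sub_le _ _).trans ?_
        rw [norm_mul, norm_mul]
    _ ≤ ‖z‖ + ‖z‖ * ‖z - 1‖ * (1 / z.re) := by gcongr
    _ = _ := by ring

theorem norm_riemannZeta_ofReal_le {σ : ℝ} (hσ : 1 < σ) : ‖riemannZeta σ‖ ≤ 2 + 1 / (σ - 1) := by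
  have h0 : 0 < σ - 1 := by linarith
  have h1 := norm_riemannZeta₁_le (z := σ) (by simp; linarith)
  have h2 : riemannZeta σ = (σ - 1 : ℂ)⁻¹ * riemannZeta₁ σ :=
    riemannZeta_eq_inv_sub_mul (by exact_mod_cast hσ.ne')
  have h3 : ‖(σ : ℂ) - 1‖ = σ - 1 := by
    rw [← Complex.ofReal_one, ← Complex.ofReal_sub, Complex.norm_real, Real.norm_of_nonneg h0.le]
  rw [h2, norm_mul, norm_inv, h3]
  rw [h3, Complex.norm_real, Real.norm_of_nonneg (by linarith), Complex.ofReal_re] at h1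
  calc (σ - 1)⁻¹ * ‖riemannZeta₁ σ‖ ≤ (σ - 1)⁻¹ * (σ * (1 + (σ - 1) / σ)) := by gcongr
    _ = 2 + 1 / (σ - 1) := by
      have : σ ≠ 0 := by linarith
      field_simp; ring

/-- The Dirichlet series of 1/ζ has coefficients μ(n) of modulus at most one, so it is dominated
termwise by the series of ζ(Re w). -/
theorem norm_inv_riemannZeta_le {w : ℂ} (hw : 1 < w.re) :
    ‖(riemannZeta w)⁻¹‖ ≤ 2 + 1 / (w.re - 1) := by
  have h1 := ArithmeticFunction.LSeries_zeta_mul_Lseries_moebius hw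
  rw [ArithmeticFunction.LSeries_zeta_eq_riemannZeta hw] at h1
  rw [← eq_inv_of_mul_eq_one_right h1]
  have hwr : (1 : ℝ) < ((w.re : ℝ) : ℂ).re := by simpa using hw
  have hterm : ∀ n, ‖LSeries.term (fun n => (ArithmeticFunction.moebius n : ℂ)) w n‖ ≤
      (LSeries.term 1 (w.re : ℂ) n).re := by
    intro n
    rcases eq_or_ne n 0 with rfl | hn
    · simp
    have hn' : (0 : ℝ) < n := by exact_mod_cast Nat.pos_of_ne_zero hn
    rw [LSeries.term_of_ne_zero hn, LSeries.term_of_ne_zero hn, norm_div,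
      Complex.norm_natCast_cpow_of_pos (Nat.pos_of_ne_zero hn)]
    have : (((1 : ℕ → ℂ) n) / (n : ℂ) ^ (w.re : ℂ)).re = 1 / (n : ℝ) ^ w.re := by
      rw [← Complex.ofReal_natCast, ← Complex.ofReal_cpow hn'.le, Pi.one_apply,
        ← Complex.ofReal_one, ← Complex.ofReal_div, Complex.ofReal_re]
    rw [this]
    gcongr
    rw [Complex.norm_intCast]
    exact_mod_cast ArithmeticFunction.abs_moebius_le_one
  have hsum : Summable (LSeries.term 1 (w.re : ℂ)) := LSeriesSummable_one_iff.2 hwr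
  have hsum' : Summable fun n => (LSeries.term 1 (w.re : ℂ) n).re :=
    (Complex.hasSum_re hsum.hasSum).summable
  calc ‖LSeries (fun n => (ArithmeticFunction.moebius n : ℂ)) w‖
      ≤ ∑' n, (LSeries.term 1 (w.re : ℂ) n).re := tsum_of_norm_bounded hsum'.hasSum hterm
    _ = (riemannZeta w.re).re := by
        rw [← Complex.re_tsum hsum, ← LSeries_one_eq_riemannZeta hwr]; rfl
    _ ≤ ‖riemannZeta w.re‖ := Complex.re_le_norm _
    _ ≤ _ := norm_riemannZeta_ofReal_le hw

/-- The factor x^u has modulus at most one on (0, 1], which leaves the integral of (1-x)^{-1/2}. -/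
theorem norm_betaIntegral_add_one_half_le {u : ℂ} (hu : 0 < u.re) :
    ‖Complex.betaIntegral (u + 1) (1 / 2)‖ ≤ 2 := by
  have hone : ∫ x in (0 : ℝ)..1, (1 - x) ^ (-(1 / 2) : ℝ) = 2 := by
    rw [intervalIntegral.integral_comp_sub_left (fun x : ℝ => x ^ (-(1 / 2) : ℝ)),
      integral_rpow (by left; norm_num)]
    norm_num
  rw [← hone, Complex.betaIntegral]
  refine intervalIntegral.norm_integral_le_of_norm_le zero_le_one ?_ ?_
  · refine (ae_of_all _ fun x hx => ?_)
    have hx0 : 0 < x := hx.1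
    have hx1 : 0 ≤ 1 - x := by linarith [hx.2]
    rw [norm_mul, Complex.norm_cpow_eq_rpow_re_of_pos hx0]
    have h1 : ‖(1 - (x : ℂ)) ^ (1 / 2 - 1 : ℂ)‖ = (1 - x) ^ (-(1 / 2) : ℝ) := by
      rw [show (1 - (x : ℂ)) = ((1 - x : ℝ) : ℂ) by simp,
        show (1 / 2 - 1 : ℂ) = ((-(1 / 2) : ℝ) : ℂ) by norm_num,
        ← Complex.ofReal_cpow hx1, Complex.norm_real,
        Real.norm_of_nonneg (Real.rpow_nonneg hx1 _)]
    rw [h1]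
    refine mul_le_of_le_one_left (Real.rpow_nonneg hx1 _) ?_
    exact Real.rpow_le_one hx0.le hx.2 (by simp; exact hu.le)
  · have := (intervalIntegral.intervalIntegrable_rpow' (a := 0) (b := 1)
      (r := (-(1 / 2) : ℝ)) (by norm_num)).comp_sub_left 1
    simpa using this.symm

/-- With u = z/2 the quotient is √π Γ(u)/Γ(u+1/2), essentially a beta value. Shifting the beta
argument to u + 1 keeps that value bounded up to Re u = 0, at the cost of the explicit factor
(u+1/2)/u. -/
theorem norm_Gammaℝ_div_Gammaℝ_add_one_le {z : ℂ} (hz : 0 < z.re) :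
    ‖Complex.Gammaℝ z / Complex.Gammaℝ (z + 1)‖ ≤ 2 * (1 + 1 / z.re) := by
  set u : ℂ := z / 2 with hu
  have hure : u.re = z.re / 2 := by simp [hu]
  have hu0 : 0 < u.re := by rw [hure]; linarith
  have hune : u ≠ 0 := by rintro h; rw [h] at hu0; simp at hu0
  have hune' : u + 1 / 2 ≠ 0 := by
    intro h
    have := congrArg Complex.re h
    simp at this; linarith
  have hG2 : Complex.Gamma (u + 1 / 2) ≠ 0 :=
    Complex.Gamma_ne_zero_of_re_pos (by simp; linarith)
  have hpi : (Real.pi : ℂ) ≠ 0 := by exact_mod_cast Real.pi_ne_zero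
  have hB := Complex.Gamma_mul_Gamma_eq_betaIntegral (s := u + 1) (t := 1 / 2)
    (by simp; linarith) (by simp)
  rw [Complex.Gamma_one_half_eq, Complex.Gamma_add_one _ hune,
    show u + 1 + 1 / 2 = (u + 1 / 2) + 1 by ring, Complex.Gamma_add_one _ hune'] at hB
  have key : Complex.Gammaℝ z / Complex.Gammaℝ (z + 1)
      = (u + 1 / 2) / u * Complex.betaIntegral (u + 1) (1 / 2) := by
    rw [Complex.Gammaℝ_def, Complex.Gammaℝ_def, show (z + 1) / 2 = u + 1 / 2 by rw [hu]; ring,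
      show -(z + 1) / 2 = -z / 2 - 1 / 2 by ring, Complex.cpow_sub _ _ hpi, ← hu]
    have h1 : (Real.pi : ℂ) ^ (-z / 2) ≠ 0 := by simp [Complex.cpow_eq_zero_iff, hpi]
    have h2 : (Real.pi : ℂ) ^ (1 / 2 : ℂ) ≠ 0 := by simp [Complex.cpow_eq_zero_iff, hpi]
    clear_value u
    generalize (Real.pi : ℂ) ^ (-z / 2) = p at h1 ⊢
    generalize (Real.pi : ℂ) ^ (1 / 2 : ℂ) = q at h2 hB ⊢
    generalize Complex.Gamma (u + 1 / 2) = G at hG2 hB ⊢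
    generalize Complex.betaIntegral (u + 1) (1 / 2) = B at hB ⊢
    field_simp at hB ⊢
    linear_combination hB
  rw [key, norm_mul, mul_comm]
  refine mul_le_mul (norm_betaIntegral_add_one_half_le hu0) ?_ (norm_nonneg _) zero_le_two
  rw [add_div, div_self hune]
  refine (norm_add_le _ _).trans ?_
  rw [norm_one]
  gcongr
  rw [hu, show (1 / 2 : ℂ) / (z / 2) = 1 / z by field_simp, norm_div, norm_one]
  exact one_div_le_one_div_of_le hz (Complex.re_le_norm z)

/-! ### The quotient xi(z)/xi(z+1) in the right half plane -/

/-- The entire function `w (w - 1) Λ(w)`, where `Λ` is the completed Riemann zeta function. -/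
noncomputable def xi (w : ℂ) : ℂ := w * (w - 1) * completedRiemannZeta₀ w + 1

theorem differentiable_xi : Differentiable ℂ xi := by
  have := differentiable_completedZeta₀
  unfold xi; fun_prop

theorem xi_one_sub (w : ℂ) : xi (1 - w) = xi w := by
  unfold xi; rw [completedRiemannZeta₀_one_sub]; ring

theorem xi_one : xi 1 = 1 := by simp [xi]

theorem xi_eq {w : ℂ} (h0 : w ≠ 0) (h1 : w ≠ 1) :
    xi w = w * (w - 1) * completedRiemannZeta w := by
  have : 1 - w ≠ 0 := sub_ne_zero.2 h1.symm
  rw [xi, completedRiemannZeta_eq]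
  field_simp
  ring

theorem completedRiemannZeta_eq_Gammaℝ_mul {w : ℂ} (hw : 0 < w.re) :
    completedRiemannZeta w = Complex.Gammaℝ w * riemannZeta w := by
  have h0 : w ≠ 0 := by rintro rfl; simp at hw
  rw [riemannZeta_def_of_ne_zero h0, mul_div_cancel₀ _ (Complex.Gammaℝ_ne_zero_of_re_pos hw)]

theorem xi_eq_of_re_pos {w : ℂ} (hw : 0 < w.re) :
    xi w = w * Complex.Gammaℝ w * riemannZeta₁ w := by
  rcases eq_or_ne w 1 with rfl | h1
  · simp [xi_one, Complex.Gammaℝ_one]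
  have h0 : w ≠ 0 := by rintro rfl; simp at hw
  have h2 : w - 1 ≠ 0 := sub_ne_zero.2 h1
  rw [xi_eq h0 h1, completedRiemannZeta_eq_Gammaℝ_mul hw, riemannZeta_eq_inv_sub_mul h1]
  field_simp

theorem xi_ne_zero {w : ℂ} (hw : 1 ≤ w.re) : xi w ≠ 0 := by
  rcases eq_or_ne w 1 with rfl | h1
  · simp [xi_one]
  have hw0 : 0 < w.re := by linarith
  have h0 : w ≠ 0 := by rintro rfl; simp at hw0
  rw [xi_eq h0 h1, completedRiemannZeta_eq_Gammaℝ_mul hw0]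
  exact mul_ne_zero (mul_ne_zero h0 (sub_ne_zero.2 h1))
    (mul_ne_zero (Complex.Gammaℝ_ne_zero_of_re_pos hw0) (riemannZeta_ne_zero_of_one_le_re hw))

theorem Gammaℝ_conj (w : ℂ) :
    Complex.Gammaℝ (starRingEnd ℂ w) = starRingEnd ℂ (Complex.Gammaℝ w) := by
  have h : (Real.pi : ℂ).arg ≠ Real.pi := by
    rw [Complex.arg_ofReal_of_nonneg Real.pi_pos.le]; exact Real.pi_ne_zero.symm
  have h2 : -(starRingEnd ℂ w) / 2 = starRingEnd ℂ (-w / 2) := by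
    rw [map_div₀, map_neg, Complex.conj_ofNat]
  rw [Complex.Gammaℝ_def, Complex.Gammaℝ_def, map_mul, ← Complex.Gamma_conj, map_div₀,
    Complex.conj_ofNat, h2, Complex.cpow_conj _ _ h, Complex.conj_ofReal]

theorem xi_conj {w : ℂ} (hw : 0 < w.re) : xi (starRingEnd ℂ w) = starRingEnd ℂ (xi w) := by
  rcases eq_or_ne w 1 with rfl | h1
  · simp [xi_one]
  have h0 : w ≠ 0 := by rintro rfl; simp at hw
  have h0' : starRingEnd ℂ w ≠ 0 := by simpa using h0
  have h1' : starRingEnd ℂ w ≠ 1 := by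
    intro h; apply h1; simpa using congrArg (starRingEnd ℂ) h
  rw [xi_eq h0 h1, xi_eq h0' h1', completedRiemannZeta_eq_Gammaℝ_mul hw,
    completedRiemannZeta_eq_Gammaℝ_mul (by simpa using hw), riemannZeta_conj, Gammaℝ_conj]
  simp

/-- The quotient of two consecutive values of `xi`. -/
noncomputable def xiRatio (z : ℂ) : ℂ := xi z / xi (z + 1)

theorem differentiableAt_xiRatio {z : ℂ} (hz : 0 ≤ z.re) : DifferentiableAt ℂ xiRatio z := by
  have h := differentiable_xi
  have : xi (z + 1) ≠ 0 := xi_ne_zero (by simpa using hz)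
  unfold xiRatio
  exact h.differentiableAt.div ((h.comp (differentiable_id.add_const 1)).differentiableAt) this

/-- On the imaginary axis 1 - z is the conjugate of z + 1, so the functional equation makes
numerator and denominator conjugate. -/
theorem norm_xiRatio_of_re_eq_zero {z : ℂ} (hz : z.re = 0) : ‖xiRatio z‖ = 1 := by
  have h1 : xi z = starRingEnd ℂ (xi (z + 1)) := by
    rw [← xi_conj (by simp [hz]), ← xi_one_sub z]
    congr 1
    apply Complex.ext <;> simp [hz]
  rw [xiRatio, norm_div, h1, Complex.norm_conj, div_self]
  exact norm_ne_zero_iff.2 (xi_ne_zero (by simp [hz]))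

/-- The quotient is a product of three factors (Gamma factors, `riemannZeta₁`, 1/ζ), each bounded
with a blow-up of order at most 1/Re z at the imaginary axis: a singularity of order three in all.
-/
theorem norm_xiRatio_le {z : ℂ} (hz : 0 < z.re) :
    ‖xiRatio z‖ ≤ 2 * (1 + 1 / z.re) * (1 + ‖z - 1‖ / z.re) * (2 + 1 / z.re) := by
  have hz1 : 1 < (z + 1).re := by simpa using hz
  have h0 : z ≠ 0 := by rintro rfl; simp at hz
  have hne : z + 1 ≠ 0 := by intro h; rw [h] at hz1; norm_num at hz1
  have hne1 : z + 1 ≠ 1 := by simpa using h0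
  have hG : Complex.Gammaℝ (z + 1) ≠ 0 := Complex.Gammaℝ_ne_zero_of_re_pos (by linarith)
  have hζ : riemannZeta (z + 1) ≠ 0 := riemannZeta_ne_zero_of_one_le_re hz1.le
  have key : xiRatio z = Complex.Gammaℝ z / Complex.Gammaℝ (z + 1) * (riemannZeta₁ z / (z + 1))
      * (riemannZeta (z + 1))⁻¹ := by
    rw [xiRatio, xi_eq_of_re_pos hz, xi_eq hne hne1, completedRiemannZeta_eq_Gammaℝ_mul
      (by linarith), add_sub_cancel_right]
    field_simp
  have hle : ‖z‖ ≤ ‖z + 1‖ := by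
    rw [Complex.norm_def, Complex.norm_def]
    apply Real.sqrt_le_sqrt
    simp only [Complex.normSq_apply, Complex.add_re, Complex.one_re, Complex.add_im,
      Complex.one_im, add_zero]
    nlinarith
  have h2 : ‖riemannZeta₁ z / (z + 1)‖ ≤ 1 + ‖z - 1‖ / z.re := by
    rw [norm_div, div_le_iff₀ (norm_pos_iff.2 hne), mul_comm]
    refine (norm_riemannZeta₁_le hz).trans ?_
    gcongr
  have h3 : ‖(riemannZeta (z + 1))⁻¹‖ ≤ 2 + 1 / z.re := by
    simpa using norm_inv_riemannZeta_le hz1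
  rw [key, norm_mul, norm_mul]
  gcongr
  exact norm_Gammaℝ_div_Gammaℝ_add_one_le hz

/-- On the unit circle the inverse of u is its conjugate, so u² + 1 is u times twice its real part.
-/
theorem norm_sq_add_one_of_norm_eq_one {u : ℂ} (hu : ‖u‖ = 1) : ‖u ^ 2 + 1‖ = 2 * |u.re| := by
  have h1 : u * starRingEnd ℂ u = 1 := by
    rw [Complex.mul_conj, Complex.normSq_eq_norm_sq, hu]; simp
  have h2 : u ^ 2 + 1 = u * ((2 * u.re : ℝ) : ℂ) := by
    rw [← Complex.add_conj, mul_add, h1]; ring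
  rw [h2, norm_mul, hu, one_mul, Complex.norm_real, Real.norm_eq_abs, abs_mul]
  norm_num

/-- Away from the imaginary axis this is `norm_xiRatio_le`. Near it, the maximum principle is
applied on the right half of the unit disc about the foot c of z on the axis, after multiplication
by a polynomial that compensates the blow-up of the bound at the two corners. -/
theorem norm_xiRatio_le_linear {z : ℂ} (hz : 0 < z.re) : ‖xiRatio z‖ ≤ 288 * (1 + ‖z‖) := by
  rcases le_or_gt (1 / 2) z.re with hz2 | hz2
  · refine (norm_xiRatio_le hz).trans ?_
    have h1 : 1 / z.re ≤ 2 := by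
      rw [div_le_iff₀ hz]; linarith
    have h2 : ‖z - 1‖ / z.re ≤ (‖z‖ + 1) * 2 := by
      rw [div_eq_mul_one_div]
      gcongr
      simpa using norm_sub_le z 1
    calc _ ≤ 2 * (1 + 2) * (1 + (‖z‖ + 1) * 2) * (2 + 2) := by gcongr
      _ ≤ _ := by linarith [norm_nonneg z]
  set c : ℂ := (z.im : ℂ) * Complex.I with hc
  have hcre : c.re = 0 := by simp [hc]
  have hcn : ‖c‖ = |z.im| := by simp [hc]
  set U : Set ℂ := {w | 0 < w.re} ∩ Metric.ball c 1 with hU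
  have hUcl : closure U ⊆ {w | 0 ≤ w.re} ∩ Metric.closedBall c 1 := by
    refine (closure_inter_subset_inter_closure _ _).trans ?_
    rw [Complex.closure_setOfPred_lt_re]
    exact inter_subset_inter_right _ Metric.closure_ball_subset_closedBall
  have hopen : IsOpen U := (isOpen_lt continuous_const Complex.continuous_re).inter Metric.isOpen_ball
  have hzc : z - c = (z.re : ℂ) := by
    rw [hc, sub_eq_iff_eq_add, Complex.re_add_im]
  have hzU : z ∈ U := by
    refine ⟨hz, ?_⟩
    rw [Metric.mem_ball, dist_eq_norm, hzc, Complex.norm_real, Real.norm_of_nonneg hz.le]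
    linarith
  -- On the arc the factor (w-c)² + 1 has modulus 2 Re w, so its cube cancels the order-three
  -- singularity of the bound. At z it is at least one, because z - c is real.
  have hd : DiffContOnCl ℂ (fun w => xiRatio w * ((w - c) ^ 2 + 1) ^ 3) U := by
    refine DifferentiableOn.diffContOnCl fun w hw => ?_
    have := differentiableAt_xiRatio (hUcl hw).1
    exact (by fun_prop : DifferentiableAt ℂ _ w).differentiableWithinAt
  have hb := Complex.norm_le_of_forall_mem_frontier_norm_le (Metric.isBounded_ball.subset
    inter_subset_right) hd (C := 288 * (1 + ‖z‖)) ?_ (subset_closure hzU)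
  · rw [norm_mul, hzc] at hb
    refine le_trans (le_mul_of_one_le_right (norm_nonneg _) ?_) hb
    rw [norm_pow]
    refine one_le_pow₀ ?_
    have : ((z.re : ℂ) ^ 2 + 1) = ((z.re ^ 2 + 1 : ℝ) : ℂ) := by simp
    rw [this, Complex.norm_real, Real.norm_of_nonneg (by positivity)]
    nlinarith
  · intro w hw
    have hwcl := hUcl (frontier_subset_closure hw)
    have hwre : 0 ≤ w.re := hwcl.1
    have hwc : ‖w - c‖ ≤ 1 := by simpa [dist_eq_norm] using hwcl.2
    have hzim : |z.im| ≤ ‖z‖ := Complex.abs_im_le_norm z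
    rw [norm_mul, norm_pow]
    rcases hwre.eq_or_lt with h0 | h0
    · rw [norm_xiRatio_of_re_eq_zero h0.symm, one_mul]
      have h2 : ‖(w - c) ^ 2 + 1‖ ≤ 2 := by
        refine (norm_add_le _ _).trans ?_
        rw [norm_pow, norm_one]
        nlinarith [norm_nonneg (w - c)]
      calc _ ≤ (2 : ℝ) ^ 3 := by gcongr
        _ ≤ _ := by linarith [norm_nonneg z]
    -- A frontier point off the axis lies on the arc.
    · have h1 : ‖w - c‖ = 1 := by
        refine le_antisymm hwc (not_lt.1 fun h => ?_)
        rw [IsOpen.frontier_eq hopen] at hw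
        refine hw.2 ⟨h0, ?_⟩
        simpa [dist_eq_norm] using h
      have hre1 : w.re ≤ 1 := by
        have := (Complex.re_le_norm (w - c)).trans hwc
        simpa [hcre] using this
      have hwn : ‖w - 1‖ ≤ ‖z‖ + 2 := by
        calc ‖w - 1‖ = ‖(w - c) + c - 1‖ := by ring_nf
          _ ≤ ‖w - c‖ + ‖c‖ + ‖(1 : ℂ)‖ := (norm_sub_le _ _).trans (by gcongr; exact norm_add_le _ _)
          _ ≤ _ := by rw [hcn, norm_one]; linarith
      rw [norm_sq_add_one_of_norm_eq_one h1]
      have hre : |(w - c).re| = w.re := by simp [hcre, abs_of_pos h0]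
      rw [hre]
      calc _ ≤ 2 * (1 + 1 / w.re) * (1 + ‖w - 1‖ / w.re) * (2 + 1 / w.re) * (2 * w.re) ^ 3 := by
            gcongr; exact norm_xiRatio_le h0
        _ = 16 * (w.re + 1) * (w.re + ‖w - 1‖) * (2 * w.re + 1) := by
            field_simp; ring
        _ ≤ 16 * (1 + 1) * (1 + (‖z‖ + 2)) * (2 * 1 + 1) := by gcongr
        _ ≤ _ := by linarith [norm_nonneg z]

theorem norm_xiRatio_le_one {z : ℂ} (hz : 0 ≤ z.re) : ‖xiRatio z‖ ≤ 1 := by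
  refine PhragmenLindelof.right_half_plane_of_bounded_on_real ?_ ⟨1, one_lt_two, 1, ?_⟩ ?_ ?_ hz
  · refine DifferentiableOn.diffContOnCl fun w hw => ?_
    rw [Complex.closure_setOfPred_lt_re] at hw
    exact (differentiableAt_xiRatio hw).differentiableWithinAt
  -- Linear growth is dominated by e^{|z|}, of order one, below the critical order two of the half
  -- plane.
  · refine Asymptotics.IsBigO.of_bound 288 ?_
    rw [eventually_inf_principal]
    refine Eventually.of_forall fun w hw => (norm_xiRatio_le_linear hw).trans ?_
    rw [Real.norm_of_nonneg (Real.exp_pos _).le, Real.rpow_one, one_mul, add_comm]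
    gcongr
    exact Real.add_one_le_exp _
  · refine isBoundedUnder_of_eventually_le (a := 2 * (1 + 1) * (1 + 1) * (2 + 1)) ?_
    filter_upwards [eventually_ge_atTop (1 : ℝ)] with x hx
    have hx0 : 0 < x := by linarith
    refine (norm_xiRatio_le (by simpa using hx0)).trans ?_
    rw [Complex.ofReal_re]
    have h1 : 1 / x ≤ 1 := by rw [div_le_one hx0]; exact hx
    have h2 : ‖(x : ℂ) - 1‖ / x ≤ 1 := by
      rw [div_le_one hx0, ← Complex.ofReal_one, ← Complex.ofReal_sub, Complex.norm_real,
        Real.norm_of_nonneg (by linarith)]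
      linarith
    gcongr
  · intro x
    exact (norm_xiRatio_of_re_eq_zero (by simp)).le

theorem norm_xiRatio_one_lt : ‖xiRatio 1‖ < 1 := by
  have h2 : xi 2 = Real.pi / 3 := by
    rw [xi_eq (by norm_num) (by norm_num), completedRiemannZeta_eq_Gammaℝ_mul (by simp),
      riemannZeta_two, Complex.Gammaℝ_def, neg_div, div_self two_ne_zero, Complex.Gamma_one,
      Complex.cpow_neg_one]
    have : (Real.pi : ℂ) ≠ 0 := by exact_mod_cast Real.pi_ne_zero
    field_simp
    norm_num
  rw [xiRatio, xi_one, one_add_one_eq_two, h2, norm_div, norm_one, norm_div, Complex.norm_real,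
    Real.norm_of_nonneg Real.pi_pos.le, Complex.norm_ofNat, one_div_div, div_lt_one Real.pi_pos]
  exact Real.pi_gt_three

/-- If the bound one were attained inside, the maximum principle would make the modulus constantly
one, contrary to its value 3/π at 1. -/
theorem norm_xiRatio_lt_one {z : ℂ} (hz : 0 < z.re) : ‖xiRatio z‖ < 1 := by
  refine (norm_xiRatio_le_one hz.le).lt_of_ne fun h => ?_
  have := Complex.norm_eqOn_of_isPreconnected_of_isMaxOn (f := xiRatio) (U := {w | 0 < w.re})
    (c := z) (convex_halfSpace_re_gt 0).isPreconnected
    (isOpen_lt continuous_const Complex.continuous_re)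
    (fun w hw => (differentiableAt_xiRatio (le_of_lt hw)).differentiableWithinAt) hz
    (fun w hw => by simpa [h] using norm_xiRatio_le_one (le_of_lt hw))
    (by simp : (1 : ℂ) ∈ {w : ℂ | 0 < w.re})
  simp only [Function.comp_apply, Function.const_apply, h] at this
  exact norm_xiRatio_one_lt.ne this

/-- If Re s > 1/2, the quotient at z = 2s - 1 would be one although Re z > 0. The functional
equation exchanges the two sides under s ↦ 1 - s. -/
theorem re_eq_one_half_of_xi_eq {s : ℂ} (h : xi (2 * s) = xi (2 * s - 1)) : s.re = 1 / 2 := by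
  have key : ∀ s : ℂ, xi (2 * s) = xi (2 * s - 1) → s.re ≤ 1 / 2 := by
    intro s h
    by_contra! hs
    have h1 := norm_xiRatio_lt_one (z := 2 * s - 1) (by simp; linarith)
    rw [xiRatio, sub_add_cancel, h, div_self, norm_one] at h1
    · exact lt_irrefl _ h1
    · rw [← h]; exact xi_ne_zero (by simp; linarith)
  refine le_antisymm (key s h) ?_
  have h2 := key (1 - s) (by
    rw [← xi_one_sub, ← xi_one_sub (2 * (1 - s) - 1), show 1 - 2 * (1 - s) = 2 * s - 1 by ring,
      show 1 - (2 * (1 - s) - 1) = 2 * s by ring, h])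
  simp at h2
  linarith

/-! ### Lattices in coordinates and their semistability -/

/-- The value at `(c, d)` of the quadratic form `|c τ + d|² / Im τ` of determinant one. -/
noncomputable def quadForm (v : Fin 2 → ℤ) (τ : ℍ) : ℝ := ‖(v 0 : ℂ) * τ + v 1‖ ^ 2 / τ.im

theorem quadForm_eq (v : Fin 2 → ℤ) (τ : ℍ) :
    quadForm v τ = ((v 0 * τ.re + v 1) ^ 2 + (v 0 * τ.im) ^ 2) / τ.im := by
  rw [quadForm, ← Complex.normSq_eq_norm_sq, Complex.normSq_apply]
  simp
  ring

theorem quadForm_nonneg (v : Fin 2 → ℤ) (τ : ℍ) : 0 ≤ quadForm v τ :=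
  div_nonneg (by positivity) τ.im_pos.le

theorem quadForm_pos {v : Fin 2 → ℤ} (hv : v ≠ 0) (τ : ℍ) : 0 < quadForm v τ := by
  have hy := τ.im_pos
  rw [quadForm_eq]
  refine div_pos ?_ hy
  by_cases h0 : v 0 = 0
  · have h1 : (v 1 : ℝ) ≠ 0 := by
      intro h1
      apply hv
      ext i
      fin_cases i
      · exact h0
      · exact_mod_cast h1
    rw [h0]
    simp only [Int.cast_zero, zero_mul, zero_add]
    positivity
  · have : (v 0 : ℝ) ≠ 0 := by exact_mod_cast h0
    positivity

theorem quadForm_zsmul (k : ℤ) (v : Fin 2 → ℤ) (τ : ℍ) :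
    quadForm (k • v) τ = (k : ℝ) ^ 2 * quadForm v τ := by
  rw [quadForm_eq, quadForm_eq]
  simp
  ring

theorem measurable_quadForm (v : Fin 2 → ℤ) : Measurable (quadForm v) := by
  have h1 : Measurable fun τ : ℍ => (τ : ℂ) := UpperHalfPlane.measurable_coe
  have h2 : Measurable fun τ : ℍ => τ.im := UpperHalfPlane.continuous_im.measurable
  unfold quadForm
  fun_prop

namespace Lattice

/-- Coordinates on the normalized lattice. -/
noncomputable def coordEquiv (p : ℍ × Set.Ioi (0 : ℝ)) :
    (Fin 2 → ℤ) ≃ₗ[ℤ] (ofPoint p).carrier :=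
  ((LinearEquiv.finTwoArrow ℤ ℤ).trans (LinearEquiv.prodComm ℤ ℤ ℤ)).trans
    (PeriodPair.mk _ _ (indep_normalized p.1 p.2)).latticeEquivProd.symm

theorem coe_coordEquiv (p : ℍ × Set.Ioi (0 : ℝ)) (v : Fin 2 → ℤ) :
    (coordEquiv p v : ℂ) = (Real.sqrt (p.2 / p.1.im) : ℝ) * ((v 0 : ℂ) * p.1 + v 1) := by
  have h := (PeriodPair.mk _ _ (indep_normalized p.1 p.2)).latticeEquiv_symm_apply (v 1, v 0)
  refine h.trans ?_
  simp only
  ring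

theorem norm_coordEquiv_sq (p : ℍ × Set.Ioi (0 : ℝ)) (v : Fin 2 → ℤ) :
    ‖(coordEquiv p v : ℂ)‖ ^ 2 = p.2 * quadForm v p.1 := by
  have hy := p.1.im_pos
  rw [coe_coordEquiv, norm_mul, mul_pow, Complex.norm_real, Real.norm_of_nonneg (Real.sqrt_nonneg _),
    Real.sq_sqrt (div_nonneg (le_of_lt p.2.2) hy.le), quadForm]
  ring

theorem volume_fundamentalDomain_basisOneI :
    (volume : Measure ℂ).real (ZSpan.fundamentalDomain Complex.basisOneI) = 1 := by
  rw [measureReal_congr (ZSpan.fundamentalDomain_ae_parallelepiped Complex.basisOneI volume)]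
  have := Complex.orthonormalBasisOneI.volume_parallelepiped
  rw [Complex.coe_orthonormalBasisOneI] at this
  rw [Complex.coe_basisOneI, measureReal_def, this, ENNReal.toReal_one]

theorem vol_ofPoint (p : ℍ × Set.Ioi (0 : ℝ)) : (ofPoint p).vol = p.2 := by
  have hy := p.1.im_pos
  have ht : (0 : ℝ) < p.2 := p.2.2
  have h := ZLattice.covolume_eq_det_mul_measureReal
    (PeriodPair.mk _ _ (indep_normalized p.1 p.2)).lattice volume
    (PeriodPair.mk _ _ (indep_normalized p.1 p.2)).latticeBasis Complex.basisOneI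
  refine Eq.trans h ?_
  rw [volume_fundamentalDomain_basisOneI, mul_one, Module.Basis.det_apply, Matrix.det_fin_two]
  simp only [Module.Basis.toMatrix_apply, Function.comp_apply, PeriodPair.latticeBasis_zero,
    PeriodPair.latticeBasis_one, Complex.coe_basisOneI_repr]
  simp only [Matrix.cons_val_zero, Matrix.cons_val_one, Complex.ofReal_re, Complex.ofReal_im,
    Complex.re_ofReal_mul, Complex.im_ofReal_mul, mul_zero, sub_zero,
    UpperHalfPlane.coe_im]
  rw [← mul_assoc, Real.mul_self_sqrt (div_pos ht hy).le, div_mul_cancel₀ _ hy.ne',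
    abs_of_pos ht]

/-- Since e^u ≥ u²/2, each term at a nonzero vector is at most 2‖x‖^{-4}, and the exponent 4 exceeds
the rank two. -/
theorem summable_gaussian (L : Lattice) :
    Summable fun x : L.carrier => Real.exp (-Real.pi * ‖(x : ℂ)‖ ^ 2) := by
  have := L.discrete
  have := L.isZLattice
  have hr : Module.finrank ℤ L.carrier < 4 := by
    rw [ZLattice.rank ℝ L.carrier, Complex.finrank_real_complex]; norm_num
  have h := ZLattice.summable_norm_pow_inv L.carrier 4 hr
  refine Summable.of_norm_bounded_eventually (h.mul_left 2) ?_
  have hne : ∀ᶠ x : L.carrier in cofinite, x ≠ 0 := by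
    simp [Filter.eventually_cofinite]
  filter_upwards [hne] with x hx
  have hx0 : 0 < ‖x‖ := norm_pos_iff.2 hx
  rw [Real.norm_of_nonneg (Real.exp_pos _).le, neg_mul, Real.exp_neg, inv_pow]
  have h1 := Real.pow_div_factorial_le_exp (x := Real.pi * ‖(x : ℂ)‖ ^ 2) (by positivity) 2
  have h2 : ‖x‖ ^ 4 / 2 ≤ Real.exp (Real.pi * ‖(x : ℂ)‖ ^ 2) := by
    refine le_trans ?_ h1
    have : (1 : ℝ) ≤ Real.pi ^ 2 := one_le_pow₀ (by linarith [Real.pi_gt_three])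
    have e : ‖(x : ℂ)‖ = ‖x‖ := rfl
    rw [e]
    norm_num
    rw [mul_pow]
    have h4 : 0 ≤ ‖x‖ ^ 4 := by positivity
    nlinarith
  calc (Real.exp (Real.pi * ‖(x : ℂ)‖ ^ 2))⁻¹ ≤ (‖x‖ ^ 4 / 2)⁻¹ := by gcongr
    _ = 2 * (‖x‖ ^ 4)⁻¹ := by rw [inv_div]; rfl

theorem one_le_tsum_gaussian (L : Lattice) :
    1 ≤ ∑' x : L.carrier, Real.exp (-Real.pi * ‖(x : ℂ)‖ ^ 2) := by
  refine le_trans ?_ (L.summable_gaussian.le_tsum 0 fun _ _ => (Real.exp_pos _).le)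
  simp

theorem exp_h0 (L : Lattice) :
    Real.exp L.h0 = ∑' x : L.carrier, Real.exp (-Real.pi * ‖(x : ℂ)‖ ^ 2) :=
  Real.exp_log (lt_of_lt_of_le one_pos L.one_le_tsum_gaussian)

theorem gaussian_coordEquiv (p : ℍ × Set.Ioi (0 : ℝ)) (v : Fin 2 → ℤ) :
    Real.exp (-Real.pi * ‖(coordEquiv p v : ℂ)‖ ^ 2)
      = Real.exp (-(Real.pi * quadForm v p.1 * p.2)) := by
  rw [norm_coordEquiv_sq]
  congr 1
  ring

theorem ofReal_exp_h0_ofPoint (p : ℍ × Set.Ioi (0 : ℝ)) :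
    ENNReal.ofReal (Real.exp (ofPoint p).h0)
      = ∑' v : Fin 2 → ℤ, ENNReal.ofReal (Real.exp (-(Real.pi * quadForm v p.1 * p.2))) := by
  rw [exp_h0, ENNReal.ofReal_tsum_of_nonneg (fun _ => (Real.exp_pos _).le) (summable_gaussian _),
    ← (coordEquiv p).toEquiv.tsum_eq]
  exact tsum_congr fun v => congrArg ENNReal.ofReal (gaussian_coordEquiv p v)

theorem ofReal_exp_h0_ofPoint_sub_one (p : ℍ × Set.Ioi (0 : ℝ)) :
    ENNReal.ofReal (Real.exp (ofPoint p).h0 - 1)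
      = ∑' v : {v : Fin 2 → ℤ // v ≠ 0},
          ENNReal.ofReal (Real.exp (-(Real.pi * quadForm v p.1 * p.2))) := by
  rw [ENNReal.ofReal_sub _ zero_le_one, ofReal_exp_h0_ofPoint,
    ENNReal.tsum_eq_add_tsum_ite (0 : Fin 2 → ℤ)]
  have h0 : quadForm 0 p.1 = 0 := by simp [quadForm]
  rw [h0, mul_zero, zero_mul, neg_zero, Real.exp_zero, ENNReal.add_sub_cancel_left (by simp)]
  refine Eq.trans ?_ (tsum_subtype {v : Fin 2 → ℤ | v ≠ 0} fun v =>
    ENNReal.ofReal (Real.exp (-(Real.pi * quadForm v p.1 * p.2)))).symm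
  refine tsum_congr fun v => ?_
  by_cases hv : v = 0 <;> simp [hv]

end Lattice

theorem exists_eq_nsmul_isCoprime {v : Fin 2 → ℤ} (hv : v ≠ 0) :
    ∃ (k : ℕ) (w : Fin 2 → ℤ), 0 < k ∧ IsCoprime (w 0) (w 1) ∧ v = (k : ℤ) • w := by
  have hg : 0 < Int.gcd (v 0) (v 1) := by
    rw [Int.gcd_pos_iff]
    by_contra! h
    apply hv
    ext i
    fin_cases i
    · exact h.1
    · exact h.2
  obtain ⟨m, n, h1, h2, h3⟩ := Int.exists_gcd_one hg
  refine ⟨_, ![m, n], hg, Int.isCoprime_iff_gcd_eq_one.2 h1, ?_⟩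
  ext i
  fin_cases i
  · simpa [mul_comm] using h2
  · simpa [mul_comm] using h3

/-- The points `τ` such that the lattice `ℤ + ℤ τ` is semistable. -/
def semistableSet : Set ℍ := {τ | ∀ v : Fin 2 → ℤ, IsCoprime (v 0) (v 1) → 1 ≤ quadForm v τ}

theorem measurableSet_semistableSet : MeasurableSet semistableSet := by
  have : semistableSet = ⋂ v : {v : Fin 2 → ℤ // IsCoprime (v 0) (v 1)},
      {τ | 1 ≤ quadForm v τ} := by
    ext τ
    simp only [mem_iInter]
    exact ⟨fun h v => h v.1 v.2, fun h v hv => h ⟨v, hv⟩⟩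
  rw [this]
  exact MeasurableSet.iInter fun v => measurableSet_le measurable_const (measurable_quadForm v)

namespace Lattice

/-- Coprime coordinates give primitive vectors, and ‖v‖² is t times the quadratic form. Conversely
every nonzero vector is a positive multiple of one with coprime coordinates, and multiples are no
shorter. -/
theorem isSemistable_ofPoint (p : ℍ × Set.Ioi (0 : ℝ)) :
    (ofPoint p).IsSemistable ↔ p.1 ∈ semistableSet := by
  have ht : (0 : ℝ) < p.2 := p.2.2
  constructor
  · intro h v hv
    have hv0 : (coordEquiv p v : ℂ) ≠ 0 := by
      have := hv.ne_zero
      simpa using this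
    have h1 := h _ (coordEquiv p v).2 hv0 ?_
    · rw [vol_ofPoint, norm_coordEquiv_sq] at h1
      exact le_of_mul_le_mul_left (by simpa using h1) ht
    · intro x hx n hn hnx
      obtain ⟨w, hw⟩ := (coordEquiv p).surjective ⟨x, hx⟩
      obtain rfl : (coordEquiv p w : ℂ) = x := congrArg Subtype.val hw
      rw [Submodule.mem_span_singleton] at hnx ⊢
      obtain ⟨a, ha⟩ := hnx
      have ha' : a • v = n • w := by
        apply (coordEquiv p).injective
        apply Subtype.ext
        rw [map_zsmul, map_zsmul]
        exact ha
      obtain ⟨α, β, hαβ⟩ := hv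
      have e0 : a * v 0 = n * w 0 := by simpa using congrFun ha' 0
      have e1 : a * v 1 = n * w 1 := by simpa using congrFun ha' 1
      -- The Bézout relation for the coprime coordinates of v shows that n divides a, and the
      -- quotient is the coefficient of v.
      have hk : a = n * (α * w 0 + β * w 1) := by
        linear_combination a * (-hαβ) + α * e0 + β * e1
      refine ⟨α * w 0 + β * w 1, ?_⟩
      have : (α * w 0 + β * w 1) • v = w := by
        ext i
        apply mul_left_cancel₀ hn
        have := congrFun ha' i
        rw [hk] at this
        simpa [mul_assoc] using this
      conv_rhs => rw [← this, map_zsmul]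
      rfl
  · intro h x hx hx0 _
    obtain ⟨v, hv⟩ := (coordEquiv p).surjective ⟨x, hx⟩
    obtain rfl : (coordEquiv p v : ℂ) = x := congrArg Subtype.val hv
    have hv0 : v ≠ 0 := by rintro rfl; simp at hx0
    obtain ⟨k, w, hk, hw, rfl⟩ := exists_eq_nsmul_isCoprime hv0
    rw [vol_ofPoint, norm_coordEquiv_sq, quadForm_zsmul]
    have h1 := h w hw
    have h2 : (1 : ℝ) ≤ ((k : ℤ) : ℝ) ^ 2 := one_le_pow₀ (by exact_mod_cast hk)
    exact le_mul_of_one_le_right ht.le (by nlinarith)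

end Lattice

/-! ### Measurability on the moduli space -/

namespace Moduli

theorem measurable_of_measurable_comp_ofPoint {β : Type*} [MeasurableSpace β] {f : Moduli → β}
    (hf : Measurable (f ∘ ofPoint)) : Measurable f := fun _ hs => hf hs

theorem measurable_ofPoint : Measurable ofPoint := fun _ hs => hs

theorem vol_ofPoint (p : ℍ × Set.Ioi (0 : ℝ)) : (ofPoint p).vol = p.2 := Lattice.vol_ofPoint p

theorem measurable_vol : Measurable vol :=
  measurable_of_measurable_comp_ofPoint <| by
    have : vol ∘ ofPoint = fun p => (p.2 : ℝ) := funext vol_ofPoint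
    rw [this]
    exact measurable_subtype_coe.comp measurable_snd

theorem h0_nonneg (Λ : Moduli) : 0 ≤ Λ.h0 := by
  induction Λ using Quotient.inductionOn with
  | h L => exact Real.log_nonneg L.one_le_tsum_gaussian

theorem measurable_gaussian (v : Fin 2 → ℤ) : Measurable fun p : ℍ × Set.Ioi (0 : ℝ) =>
    ENNReal.ofReal (Real.exp (-(Real.pi * quadForm v p.1 * p.2))) := by
  have h := measurable_quadForm v
  fun_prop

theorem measurable_h0 : Measurable h0 :=
  measurable_of_measurable_comp_ofPoint <| by
    have : h0 ∘ ofPoint = fun p => Real.log (∑' v : Fin 2 → ℤ,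
        ENNReal.ofReal (Real.exp (-(Real.pi * quadForm v p.1 * p.2)))).toReal := by
      funext p
      rw [← Lattice.ofReal_exp_h0_ofPoint, ENNReal.toReal_ofReal (Real.exp_pos _).le, Real.log_exp]
      rfl
    rw [this]
    exact Real.measurable_log.comp (Measurable.tsum measurable_gaussian).ennreal_toReal

theorem preimage_isSemistable :
    ofPoint ⁻¹' {Λ : Moduli | Λ.IsSemistable} = semistableSet ×ˢ univ := by
  ext p
  exact (Lattice.isSemistable_ofPoint p).trans (by simp)

theorem measurableSet_isSemistable : MeasurableSet {Λ : Moduli | Λ.IsSemistable} := by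
  change MeasurableSet (ofPoint ⁻¹' {Λ : Moduli | Λ.IsSemistable})
  rw [preimage_isSemistable]
  exact measurableSet_semistableSet.prod MeasurableSet.univ

end Moduli

/-! ### Integrating out the scale -/

instance : SFinite Moduli.scaleMeasure := by
  have : SigmaFinite (Measure.comap Subtype.val (volume : Measure ℝ) :
      Measure (Set.Ioi (0 : ℝ))) := by
    have : LocallyCompactSpace (Set.Ioi (0 : ℝ)) := isOpen_Ioi.locallyCompactSpace
    have : IsFiniteMeasureOnCompacts (Measure.comap Subtype.val (volume : Measure ℝ) :
        Measure (Set.Ioi (0 : ℝ))) :=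
      .comap' _ continuous_subtype_val (MeasurableEmbedding.subtype_coe measurableSet_Ioi)
    infer_instance
  unfold Moduli.scaleMeasure
  infer_instance

theorem lintegral_gaussian_scaleMeasure {σ q : ℝ} (hσ : 0 < σ) (hq : 0 < q) :
    ∫⁻ t : Set.Ioi (0 : ℝ), ENNReal.ofReal (Real.exp (-(Real.pi * q * t))) *
        ENNReal.ofReal (Real.exp (σ * Real.log t)) ∂Moduli.scaleMeasure
      = ENNReal.ofReal (Real.pi ^ (-σ) * Real.Gamma σ) * ENNReal.ofReal (q ^ (-σ)) := by
  have hr : 0 < Real.pi * q := mul_pos Real.pi_pos hq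
  have hint := Real.integral_rpow_mul_exp_neg_mul_Ioi hσ hr
  have hG : 0 < Real.Gamma σ := Real.Gamma_pos_of_pos hσ
  have h1 : Measurable fun t : Set.Ioi (0 : ℝ) => ENNReal.ofReal (1 / (t : ℝ)) := by fun_prop
  have h2 : Measurable fun t : Set.Ioi (0 : ℝ) =>
      ENNReal.ofReal (Real.exp (-(Real.pi * q * t))) *
        ENNReal.ofReal (Real.exp (σ * Real.log t)) := by fun_prop
  rw [Moduli.scaleMeasure, lintegral_withDensity_eq_lintegral_mul _ h1 h2]
  simp only [Pi.mul_apply]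
  rw [lintegral_subtype_comap measurableSet_Ioi fun t : ℝ => ENNReal.ofReal (1 / t) *
    (ENNReal.ofReal (Real.exp (-(Real.pi * q * t))) *
        ENNReal.ofReal (Real.exp (σ * Real.log t)))]
  have h3 : ∫⁻ t in Set.Ioi (0 : ℝ), ENNReal.ofReal (1 / t) *
      (ENNReal.ofReal (Real.exp (-(Real.pi * q * t))) *
        ENNReal.ofReal (Real.exp (σ * Real.log t)))
      = ∫⁻ t in Set.Ioi (0 : ℝ),
        ENNReal.ofReal (t ^ (σ - 1) * Real.exp (-(Real.pi * q * t))) := by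
    refine setLIntegral_congr_fun measurableSet_Ioi fun t ht => ?_
    have ht0 : (0 : ℝ) < t := ht
    rw [← ENNReal.ofReal_mul (Real.exp_pos _).le, ← ENNReal.ofReal_mul (by positivity),
      Real.rpow_sub_one ht0.ne', Real.rpow_def_of_pos ht0]
    congr 1
    rw [mul_comm σ]
    ring
  have hpos : 0 < (1 / (Real.pi * q)) ^ σ * Real.Gamma σ := by positivity
  rw [h3, ← ofReal_integral_eq_lintegral_ofReal, hint, ← ENNReal.ofReal_mul (by positivity)]
  · congr 1
    rw [one_div, Real.inv_rpow hr.le, ← Real.rpow_neg hr.le, Real.mul_rpow Real.pi_pos.le hq.le]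
    ring
  -- A non-integrable function would have integral 0 by convention, whereas the Gamma integral is
  -- positive.
  · by_contra h
    rw [← hint, integral_undef h] at hpos
    exact lt_irrefl _ hpos
  · filter_upwards [ae_restrict_mem measurableSet_Ioi] with t ht
    have ht0 : (0 : ℝ) < t := ht
    simp only [Pi.zero_apply]
    positivity

/-- Integrating out the scale turns the theta series into an Epstein zeta function. -/
theorem lintegral_isSemistable_eq_epstein {σ : ℝ} (hσ : 0 < σ) :
    ∫⁻ Λ in {Λ : Moduli | Λ.IsSemistable},
      ENNReal.ofReal (Real.exp Λ.h0 - 1) * ENNReal.ofReal (Real.exp (σ * Real.log Λ.vol))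
        ∂Moduli.measure
      = ENNReal.ofReal (Real.pi ^ (-σ) * Real.Gamma σ) *
        ∫⁻ τ in ModularGroup.fd ∩ semistableSet,
          ∑' v : {v : Fin 2 → ℤ // v ≠ 0}, ENNReal.ofReal (quadForm v τ ^ (-σ)) := by
  have hF : Measurable fun Λ : Moduli =>
      ENNReal.ofReal (Real.exp Λ.h0 - 1) * ENNReal.ofReal (Real.exp (σ * Real.log Λ.vol)) := by
    have := Moduli.measurable_h0
    have := Moduli.measurable_vol
    fun_prop
  have hg : ∀ v : {v : Fin 2 → ℤ // v ≠ 0}, Measurable fun p : ℍ × Set.Ioi (0 : ℝ) =>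
      ENNReal.ofReal (Real.exp (-(Real.pi * quadForm v p.1 * p.2))) *
        ENNReal.ofReal (Real.exp (σ * Real.log p.2)) := by
    intro v
    have := Moduli.measurable_gaussian v
    fun_prop
  rw [Moduli.measure, setLIntegral_map Moduli.measurableSet_isSemistable hF
    Moduli.measurable_ofPoint, Moduli.preimage_isSemistable, ← Measure.prod_restrict,
    Measure.restrict_univ, Measure.restrict_restrict measurableSet_semistableSet, inter_comm]
  have h1 : ∀ p : ℍ × Set.Ioi (0 : ℝ), ENNReal.ofReal (Real.exp (Moduli.ofPoint p).h0 - 1) *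
      ENNReal.ofReal (Real.exp (σ * Real.log (Moduli.ofPoint p).vol))
      = ∑' v : {v : Fin 2 → ℤ // v ≠ 0},
          ENNReal.ofReal (Real.exp (-(Real.pi * quadForm v p.1 * p.2))) *
            ENNReal.ofReal (Real.exp (σ * Real.log p.2)) := by
    intro p
    rw [ENNReal.tsum_mul_right, ← Lattice.ofReal_exp_h0_ofPoint_sub_one, Moduli.vol_ofPoint]
    rfl
  simp_rw [h1]
  rw [lintegral_prod _ (Measurable.tsum hg).aemeasurable, ← lintegral_const_mul']
  · refine lintegral_congr fun τ => ?_
    have hg' : ∀ v, AEMeasurable _ Moduli.scaleMeasure := fun v =>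
      ((hg v).comp (measurable_prodMk_left (x := τ))).aemeasurable
    refine (lintegral_tsum hg').trans ?_
    rw [← ENNReal.tsum_mul_left]
    exact tsum_congr fun v => lintegral_gaussian_scaleMeasure hσ (quadForm_pos v.2 τ)
  · exact ENNReal.ofReal_ne_top

open MatrixGroups

/-! ### The sum over nonzero integer vectors -/

theorem coprime_pair_bijective : Function.Bijective
    fun p : ℕ × {w : Fin 2 → ℤ // IsCoprime (w 0) (w 1)} =>
      (⟨((p.1 + 1 : ℕ) : ℤ) • p.2.1, smul_ne_zero (by exact_mod_cast Nat.succ_ne_zero p.1)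
        p.2.2.ne_zero⟩ : {v : Fin 2 → ℤ // v ≠ 0}) := by
  constructor
  · rintro ⟨k, w, hw⟩ ⟨l, u, hu⟩ h
    have h' : ((k + 1 : ℕ) : ℤ) • w = ((l + 1 : ℕ) : ℤ) • u := congrArg Subtype.val h
    have hg : ∀ (m : ℕ) (x : Fin 2 → ℤ), IsCoprime (x 0) (x 1) →
        Int.gcd (((m : ℤ) • x) 0) (((m : ℤ) • x) 1) = m := by
      intro m x hx
      rw [Pi.smul_apply, Pi.smul_apply, smul_eq_mul, smul_eq_mul, Int.gcd_mul_left,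
        Int.isCoprime_iff_gcd_eq_one.1 hx]
      simp
    have hkl : k = l := by
      have h1 := hg (k + 1) w hw
      rw [h', hg (l + 1) u hu] at h1
      omega
    subst hkl
    have : w = u := smul_right_injective _ (by exact_mod_cast Nat.succ_ne_zero k) h'
    subst this
    rfl
  · rintro ⟨v, hv⟩
    obtain ⟨k, w, hk, hw, rfl⟩ := exists_eq_nsmul_isCoprime hv
    refine ⟨(k - 1, ⟨w, hw⟩), Subtype.ext ?_⟩
    simp only [Nat.sub_add_cancel hk]

theorem tsum_ne_zero_eq (F : (Fin 2 → ℤ) → ℝ≥0∞) :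
    ∑' v : {v : Fin 2 → ℤ // v ≠ 0}, F v =
      ∑' k : ℕ, ∑' w : {w : Fin 2 → ℤ // IsCoprime (w 0) (w 1)}, F (((k + 1 : ℕ) : ℤ) • w.1) := by
  rw [← (Equiv.ofBijective _ coprime_pair_bijective).tsum_eq]
  exact ENNReal.tsum_prod (f := fun (k : ℕ) (w : {w : Fin 2 → ℤ // IsCoprime (w 0) (w 1)}) =>
    F (((k + 1 : ℕ) : ℤ) • w.1))

theorem tsum_quadForm_rpow (σ : ℝ) (τ : ℍ) :
    ∑' v : {v : Fin 2 → ℤ // v ≠ 0}, ENNReal.ofReal (quadForm v τ ^ (-σ)) =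
      (∑' k : ℕ, ENNReal.ofReal (((k + 1 : ℕ) : ℝ) ^ (-(2 * σ)))) *
        ∑' w : {w : Fin 2 → ℤ // IsCoprime (w 0) (w 1)}, ENNReal.ofReal (quadForm w τ ^ (-σ)) := by
  rw [tsum_ne_zero_eq fun v => ENNReal.ofReal (quadForm v τ ^ (-σ)), ← ENNReal.tsum_mul_right]
  refine tsum_congr fun k => ?_
  rw [← ENNReal.tsum_mul_left]
  refine tsum_congr fun w => ?_
  rw [quadForm_zsmul, ← ENNReal.ofReal_mul (by positivity),
    Real.mul_rpow (by positivity) (quadForm_nonneg _ _), Int.cast_natCast,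
    ← Real.rpow_natCast, ← Real.rpow_mul (by positivity)]
  congr 3
  push_cast
  ring

/-! ### The modular group action -/

/-- This identity drives the unfolding: the sum of q^{-σ} over coprime pairs becomes a sum of
Im(γτ)^σ. -/
theorem quadForm_row (γ : SL(2, ℤ)) (τ : ℍ) : quadForm (γ 1) τ = (γ • τ).im⁻¹ := by
  rw [ModularGroup.im_smul_eq_div_normSq, ModularGroup.denom_apply, quadForm,
    Complex.normSq_eq_norm_sq, inv_div]

theorem quadForm_smul (v : Fin 2 → ℤ) (γ : SL(2, ℤ)) (τ : ℍ) :
    quadForm v (γ • τ) = quadForm (Matrix.vecMul v (γ : Matrix (Fin 2) (Fin 2) ℤ)) τ := by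
  have hd : ((γ 1 0 : ℤ) : ℂ) * τ + (γ 1 1 : ℤ) ≠ 0 := by
    have := UpperHalfPlane.denom_ne_zero (γ : GL (Fin 2) ℝ) τ
    rwa [ModularGroup.denom_apply] at this
  have hn : ‖((γ 1 0 : ℤ) : ℂ) * τ + (γ 1 1 : ℤ)‖ ≠ 0 := norm_ne_zero_iff.2 hd
  have h1 : (v 0 : ℂ) * ((γ • τ : ℍ) : ℂ) + v 1 =
      (((Matrix.vecMul v (γ : Matrix (Fin 2) (Fin 2) ℤ) 0 : ℤ) : ℂ) * τ +
        (Matrix.vecMul v (γ : Matrix (Fin 2) (Fin 2) ℤ) 1 : ℤ)) /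
        (((γ 1 0 : ℤ) : ℂ) * τ + (γ 1 1 : ℤ)) := by
    rw [UpperHalfPlane.coe_specialLinearGroup_apply, eq_div_iff hd]
    simp only [Matrix.vecMul_eq_sum, Fin.sum_univ_two, Pi.add_apply, Pi.smul_apply, smul_eq_mul,
      algebraMap_int_eq, eq_intCast, Complex.ofReal_intCast, Int.cast_add, Int.cast_mul]
    rw [add_mul, mul_assoc, div_mul_cancel₀ _ hd]
    ring
  rw [quadForm, quadForm, h1, ModularGroup.im_smul_eq_div_normSq, ModularGroup.denom_apply,
    Complex.normSq_eq_norm_sq, norm_div, div_pow,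
    div_div_div_cancel_right₀ (pow_ne_zero 2 hn)]

theorem smul_mem_semistableSet (γ : SL(2, ℤ)) {τ : ℍ} (h : τ ∈ semistableSet) :
    γ • τ ∈ semistableSet := by
  intro v hv
  rw [quadForm_smul]
  exact h _ (hv.vecMulSL γ)

theorem smul_mem_semistableSet_iff (γ : SL(2, ℤ)) {τ : ℍ} :
    γ • τ ∈ semistableSet ↔ τ ∈ semistableSet := by
  refine ⟨fun h => ?_, smul_mem_semistableSet γ⟩
  simpa using smul_mem_semistableSet γ⁻¹ h

instance : Countable SL(2, ℤ) :=
  have : Countable (Matrix (Fin 2) (Fin 2) ℤ) := inferInstanceAs (Countable (Fin 2 → Fin 2 → ℤ))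
  Subtype.val_injective.countable

theorem measurePreserving_modular_smul (γ : SL(2, ℤ)) :
    MeasurePreserving (fun τ : ℍ => γ • τ) volume volume :=
  measurePreserving_smul (γ : GL (Fin 2) ℝ) (volume : Measure ℍ)

theorem measurableEmbedding_modular_smul (γ : SL(2, ℤ)) :
    MeasurableEmbedding (fun τ : ℍ => γ • τ) :=
  measurableEmbedding_const_smul (γ : GL (Fin 2) ℝ)

theorem volume_eq_zero_of_image {s : Set ℍ} {t : Set ℂ} (ht : volume t = 0)
    (h : ∀ τ ∈ s, (τ : ℂ) ∈ t) : volume s = 0 := by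
  rw [UpperHalfPlane.volume_eq_lintegral]
  refine setLIntegral_measure_zero _ _ (measure_mono_null ?_ ht)
  rintro _ ⟨τ, hτ, rfl⟩
  exact h τ hτ

theorem volume_setOf_re_eq (a : ℝ) : (volume : Measure ℂ) {z | z.re = a} = 0 := by
  rw [← Complex.frontier_setOfPred_lt_re a]
  exact (convex_halfSpace_re_gt a).addHaar_frontier volume

theorem volume_fd_sdiff_fdo : (volume : Measure ℍ) (ModularGroup.fd \ ModularGroup.fdo) = 0 := by
  refine volume_eq_zero_of_image (t := Metric.sphere 0 1 ∪ ({z | z.re = 1 / 2} ∪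
    {z | z.re = -(1 / 2)})) ?_ ?_
  · rw [measure_union_null_iff, measure_union_null_iff]
    exact ⟨Measure.addHaar_sphere _ _ _, volume_setOf_re_eq _, volume_setOf_re_eq _⟩
  · rintro τ ⟨⟨h1, h2⟩, h3⟩
    by_contra h
    apply h3
    simp only [mem_union, not_or, mem_sphere_zero_iff_norm] at h
    obtain ⟨ha, hb, hc⟩ := h
    refine ⟨lt_of_le_of_ne h1 fun h => ha ?_, lt_of_le_of_ne h2 fun h => ?_⟩
    · rw [Complex.normSq_eq_norm_sq] at h
      nlinarith [norm_nonneg (τ : ℂ)]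
    · rcases eq_or_eq_neg_of_abs_eq h with h | h
      · exact hb h
      · exact hc h

/-- Off the null set of points with a translate on the boundary of the domain, exactly two group
elements, γ₀ and -γ₀, carry τ into it. -/
theorem ae_tsum_indicator_fd : ∀ᵐ τ : ℍ,
    ∑' γ : SL(2, ℤ), (ModularGroup.fd.indicator (1 : ℍ → ℝ≥0∞) (γ • τ)) = 2 := by
  have hnull : ∀ᵐ τ : ℍ, ∀ γ : SL(2, ℤ), γ • τ ∉ ModularGroup.fd \ ModularGroup.fdo := by
    rw [ae_all_iff]
    intro γ
    refine (measure_eq_zero_iff_ae_notMem (s := (fun τ : ℍ => γ • τ) ⁻¹'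
      (ModularGroup.fd \ ModularGroup.fdo))).1 ?_
    exact (measurePreserving_modular_smul γ).quasiMeasurePreserving.preimage_null
      volume_fd_sdiff_fdo
  filter_upwards [hnull] with τ hτ
  obtain ⟨γ₀, h₀⟩ := ModularGroup.exists_smul_mem_fd τ
  have h₀' : γ₀ • τ ∈ ModularGroup.fdo := by
    by_contra h
    exact hτ γ₀ ⟨h₀, h⟩
  have hne : γ₀ ≠ -γ₀ := by
    intro h
    have h1 := congrArg (fun g : SL(2, ℤ) => (g : Matrix (Fin 2) (Fin 2) ℤ)) h
    have h2 : ∀ i j, γ₀ i j = 0 := fun i j => by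
      have := congrFun (congrFun h1 i) j
      simp at this
      omega
    have := γ₀.det_coe
    rw [Matrix.det_fin_two] at this
    simp [h2] at this
  have hiff : ∀ γ : SL(2, ℤ), γ • τ ∈ ModularGroup.fd ↔ γ ∈ ({γ₀, -γ₀} : Finset SL(2, ℤ)) := by
    intro γ
    simp only [Finset.mem_insert, Finset.mem_singleton]
    constructor
    · intro h
      have h1 : (γ * γ₀⁻¹) • γ₀ • τ ∈ ModularGroup.fd := by
        rwa [smul_smul, inv_mul_cancel_right]
      rcases ModularGroup.eq_one_or_neg_one_of_mem_fdo_mem_fd h₀' h1 with h2 | h2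
      · exact Or.inl (mul_inv_eq_one.1 h2)
      · right
        rw [mul_inv_eq_iff_eq_mul] at h2
        rw [h2, neg_mul, one_mul]
    · rintro (rfl | rfl)
      · exact h₀
      · rwa [ModularGroup.SL_neg_smul]
  rw [tsum_eq_sum (s := {γ₀, -γ₀}) fun γ hγ => indicator_of_notMem (mt (hiff γ).1 hγ) _,
    Finset.sum_congr rfl fun γ hγ => indicator_of_mem ((hiff γ).2 hγ) _]
  rw [Finset.sum_pair hne, Pi.one_apply, Pi.one_apply, one_add_one_eq_two]

theorem measurableSet_fd : MeasurableSet ModularGroup.fd := ModularGroup.isClosed_fd.measurableSet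

/-- Integration over the upper half plane, folded onto the fundamental domain. The factor two
accounts for the trivial action of `-1`. -/
theorem tsum_lintegral_fd_smul {h : ℍ → ℝ≥0∞} (hh : Measurable h) :
    ∑' γ : SL(2, ℤ), ∫⁻ τ in ModularGroup.fd, h (γ • τ) = 2 * ∫⁻ τ, h τ := by
  have h1 : ∀ γ : SL(2, ℤ), ∫⁻ τ in ModularGroup.fd, h (γ • τ) =
      ∫⁻ τ : ℍ, ModularGroup.fd.indicator 1 (γ⁻¹ • τ) * h τ := by
    intro γ
    rw [← (measurePreserving_modular_smul γ).lintegral_comp_emb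
      (measurableEmbedding_modular_smul γ), ← lintegral_indicator measurableSet_fd]
    refine lintegral_congr fun τ => ?_
    rw [inv_smul_smul]
    by_cases hτ : τ ∈ ModularGroup.fd <;> simp [hτ]
  have hm : ∀ γ : SL(2, ℤ), Measurable fun τ : ℍ =>
      ModularGroup.fd.indicator (1 : ℍ → ℝ≥0∞) (γ • τ) := fun γ =>
    (measurable_one.indicator measurableSet_fd).comp (measurePreserving_modular_smul γ).measurable
  simp_rw [h1]
  rw [← (Equiv.inv SL(2, ℤ)).tsum_eq]
  simp only [Equiv.inv_apply, inv_inv]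
  refine (lintegral_tsum fun γ => ((hm γ).mul hh).aemeasurable).symm.trans ?_
  rw [← lintegral_const_mul _ hh]
  refine lintegral_congr_ae ?_
  filter_upwards [ae_tsum_indicator_fd] with τ hτ
  simp only [Pi.mul_apply]
  rw [ENNReal.tsum_mul_right, hτ]

/-- The strip `-1/2 ≤ Re τ < 1/2`. -/
def strip : Set ℍ := {τ | τ.re ∈ Ico (-(1 / 2) : ℝ) (1 / 2)}

theorem measurableSet_strip : MeasurableSet strip :=
  UpperHalfPlane.continuous_re.measurable measurableSet_Ico

/-- Matrices with the same bottom row differ by a power of T on the left, which translates γτ by an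
integer; the half-open strip meets each class of translates once. -/
theorem bottomRow_bijective (τ : ℍ) : Function.Bijective
    fun γ : {γ : SL(2, ℤ) // γ • τ ∈ strip} =>
      (⟨γ.1 1, ModularGroup.bottom_row_coprime γ.1⟩ :
        {w : Fin 2 → ℤ // IsCoprime (w 0) (w 1)}) := by
  constructor
  · rintro ⟨γ, hγ⟩ ⟨δ, hδ⟩ h
    have h' : γ 1 = δ 1 := congrArg Subtype.val h
    have h0 : γ 1 0 = δ 1 0 := congrFun h' 0
    have h1 : γ 1 1 = δ 1 1 := congrFun h' 1
    have hdγ := γ.det_coe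
    have hdδ := δ.det_coe
    rw [Matrix.det_fin_two] at hdγ hdδ
    obtain ⟨n, hn⟩ : ∃ n : ℤ, δ = ModularGroup.T ^ n * γ := by
      -- The exponent is the upper right entry of δγ⁻¹.
      refine ⟨γ 0 0 * δ 0 1 - δ 0 0 * γ 0 1, ?_⟩
      ext i j
      rw [Matrix.SpecialLinearGroup.coe_mul, ModularGroup.coe_T_zpow, Matrix.mul_apply,
        Fin.sum_univ_two]
      fin_cases i <;> fin_cases j
      · simp
        rw [← h0, ← h1] at hdδ
        linear_combination δ 0 0 * hdγ * (-1) + γ 0 0 * hdδ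
      · simp
        rw [← h0, ← h1] at hdδ
        linear_combination δ 0 1 * hdγ * (-1) + γ 0 1 * hdδ
      · simp [h0]
      · simp [h1]
    have hre : (δ • τ).re = (γ • τ).re + n := by
      rw [hn, mul_smul, ModularGroup.re_T_zpow_smul]
    have hn0 : n = 0 := by
      have ha : (n : ℝ) < 1 := by linarith [hγ.1, hδ.2]
      have hb : (-1 : ℝ) < n := by linarith [hγ.2, hδ.1]
      have ha' : n < 1 := by exact_mod_cast ha
      have hb' : -1 < n := by exact_mod_cast hb
      omega
    rw [hn0, zpow_zero, one_mul] at hn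
    exact Subtype.ext hn.symm
  · rintro ⟨w, hw⟩
    obtain ⟨γ, -, hγ⟩ := ModularGroup.bottom_row_surj hw
    set n : ℤ := -⌊(γ • τ).re + 1 / 2⌋ with hn
    refine ⟨⟨ModularGroup.T ^ n * γ, ?_⟩, Subtype.ext ?_⟩
    · rw [mul_smul]
      change (ModularGroup.T ^ n • γ • τ).re ∈ Ico (-(1 / 2) : ℝ) (1 / 2)
      rw [ModularGroup.re_T_zpow_smul, hn]
      have ha := Int.floor_le ((γ • τ).re + 1 / 2)
      have hb := Int.lt_floor_add_one ((γ • τ).re + 1 / 2)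
      push_cast
      constructor <;> linarith
    · refine Eq.trans ?_ hγ
      ext j
      change ((ModularGroup.T ^ n * γ : SL(2, ℤ)) : Matrix (Fin 2) (Fin 2) ℤ) 1 j = γ 1 j
      rw [Matrix.SpecialLinearGroup.coe_mul, ModularGroup.coe_T_zpow, Matrix.mul_apply,
        Fin.sum_univ_two]
      simp

theorem tsum_strip_bottomRow (τ : ℍ) (f : (Fin 2 → ℤ) → ℝ≥0∞) :
    ∑' γ : SL(2, ℤ), strip.indicator (fun _ => f (γ 1)) (γ • τ) =
      ∑' w : {w : Fin 2 → ℤ // IsCoprime (w 0) (w 1)}, f w := by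
  rw [← (Equiv.ofBijective _ (bottomRow_bijective τ)).tsum_eq]
  refine Eq.trans ?_ (tsum_subtype {γ : SL(2, ℤ) | γ • τ ∈ strip} fun γ => f (γ 1)).symm
  refine tsum_congr fun γ => ?_
  by_cases h : γ • τ ∈ strip
  · rw [indicator_of_mem h, indicator_of_mem (show γ ∈ {γ : SL(2, ℤ) | γ • τ ∈ strip} from h)]
  · rw [indicator_of_notMem h,
      indicator_of_notMem (show γ ∉ {γ : SL(2, ℤ) | γ • τ ∈ strip} from h)]

/-- The unfolding identity. -/
theorem lintegral_fd_tsum_coprime (σ : ℝ) :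
    ∫⁻ τ in ModularGroup.fd ∩ semistableSet,
        ∑' w : {w : Fin 2 → ℤ // IsCoprime (w 0) (w 1)}, ENNReal.ofReal (quadForm w τ ^ (-σ))
      = 2 * ∫⁻ τ in strip ∩ semistableSet, ENNReal.ofReal (τ.im ^ σ) := by
  have him : Measurable fun τ : ℍ => ENNReal.ofReal (τ.im ^ σ) := by
    have : Measurable fun τ : ℍ => τ.im := UpperHalfPlane.continuous_im.measurable
    fun_prop
  have hS := measurableSet_strip.inter measurableSet_semistableSet
  rw [← lintegral_indicator hS, ← tsum_lintegral_fd_smul (him.indicator hS), inter_comm,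
    ← Measure.restrict_restrict measurableSet_semistableSet,
    ← lintegral_indicator measurableSet_semistableSet]
  refine Eq.trans ?_ (lintegral_tsum fun γ => ((him.indicator hS).comp
      (measurePreserving_modular_smul γ).measurable).aemeasurable)
  refine lintegral_congr fun τ => ?_
  by_cases hτ : τ ∈ semistableSet
  · rw [indicator_of_mem hτ, ← tsum_strip_bottomRow τ fun w => ENNReal.ofReal (quadForm w τ ^ (-σ))]
    refine tsum_congr fun γ => ?_
    have hγ := (smul_mem_semistableSet_iff γ).2 hτ
    by_cases h : γ • τ ∈ strip
    · rw [indicator_of_mem h,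
        indicator_of_mem (show γ • τ ∈ strip ∩ semistableSet from ⟨h, hγ⟩), quadForm_row,
        Real.inv_rpow (γ • τ).im_pos.le, Real.rpow_neg (γ • τ).im_pos.le, inv_inv]
    · rw [indicator_of_notMem h]
      exact (indicator_of_notMem (s := strip ∩ semistableSet) (fun h' => h h'.1) _).symm
  · rw [indicator_of_notMem hτ]
    refine (ENNReal.tsum_eq_zero.2 fun γ => indicator_of_notMem
      (s := strip ∩ semistableSet) (fun h' => hτ ?_) _).symm
    exact (smul_mem_semistableSet_iff γ).1 h'.2

/-! ### The tiling of the strip by semistable points and horoballs -/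

open Classical in
/-- The indicator function of the horoball tangent to the real line at `-d / n`, where `n` and `d`
are coprime. -/
noncomputable def horoball (n : ℕ) (d : ℤ) (x y : ℝ) : ℝ≥0∞ :=
  if IsCoprime (n : ℤ) d ∧ (n * x + d) ^ 2 + (n * y) ^ 2 < y then 1 else 0

theorem quadForm_lt_one_iff (v : Fin 2 → ℤ) (τ : ℍ) :
    quadForm v τ < 1 ↔ (v 0 * τ.re + v 1) ^ 2 + (v 0 * τ.im) ^ 2 < τ.im := by
  rw [quadForm_eq, div_lt_one τ.im_pos]

/-- Disjointness of the Ford discs. By Lagrange's identity the product of the two form values is at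
least the square of the determinant of (u, v); this integer is then 0, and coprime proportional
vectors with positive first entries coincide. -/
theorem eq_of_quadForm_lt_one {u v : Fin 2 → ℤ} {τ : ℍ} (hu : IsCoprime (u 0) (u 1))
    (hv : IsCoprime (v 0) (v 1)) (hu0 : 0 < u 0) (hv0 : 0 < v 0) (hu1 : quadForm u τ < 1)
    (hv1 : quadForm v τ < 1) : u 0 = v 0 ∧ u 1 = v 1 := by
  rw [quadForm_lt_one_iff] at hu1 hv1
  have hy := τ.im_pos
  set x := τ.re
  set y := τ.im
  have hD : ((u 0 * v 1 - u 1 * v 0 : ℤ) : ℝ) ^ 2 < 1 := by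
    have h1 : ((u 0 * x + u 1) ^ 2 + (u 0 * y) ^ 2) * ((v 0 * x + v 1) ^ 2 + (v 0 * y) ^ 2)
        < y * y := mul_lt_mul'' hu1 hv1 (by positivity) (by positivity)
    have h2 : (((u 0 * v 1 - u 1 * v 0 : ℤ) : ℝ) ^ 2) * (y * y) < 1 * (y * y) := by
      rw [one_mul]
      refine lt_of_le_of_lt ?_ h1
      push_cast
      have := sq_nonneg ((u 0 * x + u 1) * (v 0 * x + v 1) + (u 0 * y) * (v 0 * y))
      linear_combination this
    exact lt_of_mul_lt_mul_right h2 (by positivity)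
  have hD0 : u 0 * v 1 - u 1 * v 0 = 0 := by
    have h1 : (u 0 * v 1 - u 1 * v 0) ^ 2 < 1 := by exact_mod_cast hD
    exact pow_eq_zero_iff two_ne_zero |>.1 (le_antisymm (Int.lt_add_one_iff.1 (by simpa using h1))
      (sq_nonneg _))
  have h1 : u 0 ∣ v 0 := hu.dvd_of_dvd_mul_left ⟨v 1, by linarith⟩
  have h2 : v 0 ∣ u 0 := hv.dvd_of_dvd_mul_left ⟨u 1, by linarith⟩
  have h3 : u 0 = v 0 := Int.dvd_antisymm hu0.le hv0.le h1 h2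
  refine ⟨h3, ?_⟩
  rw [h3] at hD0
  exact (mul_left_cancel₀ hv0.ne' (by linarith : v 0 * v 1 = v 0 * u 1)).symm

/-- The vectors (0, ±1) account for the condition Im τ ≤ 1. Any other destabilizing primitive
vector, up to sign, has positive first entry and names the unique disc containing τ; every disc lies
below height one. -/
theorem indicator_im_le_one (τ : ℍ) :
    {τ : ℍ | τ.im ≤ 1}.indicator (1 : ℍ → ℝ≥0∞) τ =
      semistableSet.indicator 1 τ + ∑' p : ℕ × ℤ, horoball (p.1 + 1) p.2 τ.re τ.im := by
  have hy := τ.im_pos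
  have hhoro : ∀ p : ℕ × ℤ, horoball (p.1 + 1) p.2 τ.re τ.im ≠ 0 ↔
      IsCoprime ((p.1 + 1 : ℕ) : ℤ) p.2 ∧ quadForm ![((p.1 + 1 : ℕ) : ℤ), p.2] τ < 1 := by
    intro p
    rw [quadForm_lt_one_iff]
    simp [horoball]
  have h01 : quadForm ![0, 1] τ = τ.im⁻¹ := by simp [quadForm]
  by_cases hss : τ ∈ semistableSet
  · have him : τ.im ≤ 1 := by
      have := hss ![0, 1] isCoprime_one_right
      rwa [h01, one_le_inv₀ hy] at this
    rw [indicator_of_mem hss, indicator_of_mem (show τ ∈ {τ : ℍ | τ.im ≤ 1} from him),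
      ENNReal.tsum_eq_zero.2, add_zero]
    intro p
    by_contra h
    obtain ⟨h1, h2⟩ := (hhoro p).1 h
    exact absurd (hss _ h1) (not_le.2 h2)
  rw [indicator_of_notMem hss, zero_add]
  by_cases him : τ.im ≤ 1
  · rw [indicator_of_mem (show τ ∈ {τ : ℍ | τ.im ≤ 1} from him)]
    obtain ⟨v, hv, hv1, hv0⟩ : ∃ v : Fin 2 → ℤ, IsCoprime (v 0) (v 1) ∧ quadForm v τ < 1 ∧
        0 < v 0 := by
      unfold semistableSet at hss
      simp only [mem_ofPred_eq, not_forall, not_le] at hss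
      obtain ⟨v, hv, hv1⟩ := hss
      rcases lt_trichotomy (v 0) 0 with h | h | h
      · refine ⟨-v, by simpa using hv.neg_neg, ?_, by simpa using h⟩
        rw [quadForm_lt_one_iff] at hv1 ⊢
        refine lt_of_eq_of_lt ?_ hv1
        simp
        ring
      · exfalso
        rw [h, isCoprime_zero_left] at hv
        have h2 : ((v 1 : ℤ) : ℝ) ^ 2 = 1 := by
          rcases Int.isUnit_iff.1 hv with h | h <;> simp [h]
        rw [quadForm_lt_one_iff, h] at hv1
        simp only [Int.cast_zero, zero_mul, zero_add, h2] at hv1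
        nlinarith
      · exact ⟨v, hv, hv1, h⟩
    obtain ⟨n, hn⟩ : ∃ n : ℕ, v 0 = ((n + 1 : ℕ) : ℤ) := ⟨(v 0).toNat - 1, by omega⟩
    have hvec : ![((n + 1 : ℕ) : ℤ), v 1] = v := by
      ext i
      fin_cases i <;> simp [hn]
    have hne : horoball (n + 1) (v 1) τ.re τ.im ≠ 0 := by
      refine (hhoro (n, v 1)).2 ?_
      rw [hvec, ← hn]
      exact ⟨hv, hv1⟩
    rw [tsum_eq_single (n, v 1)]
    · unfold horoball at hne ⊢
      rw [ite_ne_right_iff] at hne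
      exact (if_pos hne.1).symm
    · rintro ⟨m, d⟩ hmd
      by_contra h
      obtain ⟨h1, h2⟩ := (hhoro (m, d)).1 h
      have := eq_of_quadForm_lt_one (u := ![((m + 1 : ℕ) : ℤ), d]) h1 hv
        (by simp) hv0 h2 hv1
      simp only [Matrix.cons_val_zero, Matrix.cons_val_one, hn] at this
      refine hmd (Prod.ext ?_ this.2)
      have := this.1
      simp only
      omega
  · rw [indicator_of_notMem (show τ ∉ {τ : ℍ | τ.im ≤ 1} from him), ENNReal.tsum_eq_zero.2]
    intro p
    by_contra h
    have h2 := ((hhoro p).1 h).2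
    rw [quadForm_lt_one_iff] at h2
    simp only [Matrix.cons_val_zero, Matrix.cons_val_one, Int.cast_natCast] at h2
    push_cast at h2
    have h3 : (1 : ℝ) ≤ (p.1 + 1) := by linarith [(Nat.cast_nonneg p.1 : (0 : ℝ) ≤ p.1)]
    have h4 : τ.im ≤ (p.1 + 1) * τ.im := le_mul_of_one_le_left hy.le h3
    have h5 : τ.im * 1 ≤ ((p.1 + 1) * τ.im) * ((p.1 + 1) * τ.im) :=
      mul_le_mul h4 (by linarith) zero_le_one (by positivity)
    have h6 := sq_nonneg ((p.1 + 1) * τ.re + p.2)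
    nlinarith

/-! ### Integration over the strip -/

theorem lintegral_upperHalfPlane {G : ℝ → ℝ → ℝ≥0∞} (hG : Measurable (Function.uncurry G)) :
    ∫⁻ τ : ℍ, G τ.re τ.im = ∫⁻ y in Ioi (0 : ℝ), ENNReal.ofReal (y ^ (-2 : ℝ)) * ∫⁻ x, G x y := by
  have hG2 : Measurable fun z : ℂ => ENNReal.ofReal (z.im ^ (-2 : ℝ)) * G z.re z.im := by
    have : Measurable fun z : ℂ => G z.re z.im :=
      hG.comp (Complex.measurable_re.prodMk Complex.measurable_im)
    fun_prop
  have hG3 : Measurable fun τ : ℍ => G τ.re τ.im :=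
    hG.comp (UpperHalfPlane.continuous_re.measurable.prodMk
      UpperHalfPlane.continuous_im.measurable)
  have hd : Measurable fun z : ℍ => ((1 / NNReal.mk z.im z.im_pos.le : NNReal) ^ 2 : NNReal) := by
    have : Measurable fun z : ℍ => NNReal.mk z.im z.im_pos.le :=
      UpperHalfPlane.continuous_im.measurable.subtype_mk
    fun_prop
  rw [UpperHalfPlane.volume_def, lintegral_withDensity_eq_lintegral_mul _ hd.coe_nnreal_ennreal hG3]
  have h1 : ∀ τ : ℍ, ((fun z : ℍ => (((1 / NNReal.mk z.im z.im_pos.le : NNReal) ^ 2 : NNReal) :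
      ℝ≥0∞)) * fun τ : ℍ => G τ.re τ.im) τ =
      (fun z : ℂ => ENNReal.ofReal (z.im ^ (-2 : ℝ)) * G z.re z.im) (τ : ℂ) := by
    intro τ
    simp only [Pi.mul_apply]
    congr 1
    rw [← ENNReal.ofReal_coe_nnreal]
    congr 1
    simp only [UpperHalfPlane.coe_im, NNReal.coe_pow, NNReal.coe_div, NNReal.coe_one,
      NNReal.coe_mk]
    rw [Real.rpow_neg τ.im_pos.le, one_div, inv_pow]
    norm_num
  have hrange : range ((↑) : ℍ → ℂ) = {z : ℂ | 0 < z.im} := UpperHalfPlane.range_coe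
  rw [lintegral_congr h1, ← UpperHalfPlane.measurableEmbedding_coe.lintegral_map
      (fun z : ℂ => ENNReal.ofReal (z.im ^ (-2 : ℝ)) * G z.re z.im),
    UpperHalfPlane.measurableEmbedding_coe.map_comap, hrange,
    ← lintegral_indicator (measurableSet_lt measurable_const Complex.measurable_im),
    ← Complex.volume_preserving_equiv_real_prod.symm.lintegral_comp (hG2.indicator
      (measurableSet_lt measurable_const Complex.measurable_im)), Measure.volume_eq_prod,
    lintegral_prod_symm, ← lintegral_indicator measurableSet_Ioi]
  · refine lintegral_congr fun y => ?_
    have hGy : Measurable fun x => G x y := hG.comp (measurable_id.prodMk measurable_const)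
    by_cases hy : y ∈ Ioi (0 : ℝ)
    · rw [indicator_of_mem hy, ← lintegral_const_mul _ hGy]
      refine lintegral_congr fun x => ?_
      rw [Complex.measurableEquivRealProd_symm_apply, indicator_of_mem]
      exact hy
    · rw [indicator_of_notMem hy]
      refine (lintegral_congr fun x => ?_).trans lintegral_zero
      rw [Complex.measurableEquivRealProd_symm_apply, indicator_of_notMem]
      exact hy
  · exact ((hG2.indicator (measurableSet_lt measurable_const Complex.measurable_im)).comp
      Complex.measurableEquivRealProd.symm.measurable).aemeasurable

theorem lintegral_strip {F : ℝ → ℝ → ℝ≥0∞} (hF : Measurable (Function.uncurry F)) (σ : ℝ) :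
    ∫⁻ τ in strip, ENNReal.ofReal (τ.im ^ σ) * F τ.re τ.im =
      ∫⁻ y in Ioi (0 : ℝ), ENNReal.ofReal (y ^ (σ - 2)) *
        ∫⁻ x in Ico (-(1 / 2) : ℝ) (1 / 2), F x y := by
  have hG : Measurable (Function.uncurry fun x y : ℝ =>
      (Ico (-(1 / 2) : ℝ) (1 / 2)).indicator (fun x => ENNReal.ofReal (y ^ σ) * F x y) x) := by
    have h1 : Measurable fun p : ℝ × ℝ => ENNReal.ofReal (p.2 ^ σ) * F p.1 p.2 := by
      have : Measurable fun p : ℝ × ℝ => F p.1 p.2 := hF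
      fun_prop
    have h2 := h1.indicator (measurable_fst measurableSet_Ico :
      MeasurableSet ((Prod.fst : ℝ × ℝ → ℝ) ⁻¹' Ico (-(1 / 2) : ℝ) (1 / 2)))
    exact h2
  have h := lintegral_upperHalfPlane hG
  rw [← lintegral_indicator measurableSet_strip]
  refine Eq.trans (lintegral_congr fun τ => ?_) (h.trans ?_)
  · rfl
  · refine setLIntegral_congr_fun measurableSet_Ioi fun y hy => ?_
    have hy0 : (0 : ℝ) < y := hy
    have hFy : Measurable fun x => F x y := hF.comp (measurable_id.prodMk measurable_const)
    rw [lintegral_indicator measurableSet_Ico, lintegral_const_mul _ hFy, ← mul_assoc,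
      ← ENNReal.ofReal_mul (by positivity), ← Real.rpow_add hy0, neg_add_eq_sub]

theorem lintegral_Ico_tsum_int {g : ℝ → ℝ≥0∞} (hg : Measurable g) :
    ∫⁻ x in Ico (-(1 / 2) : ℝ) (1 / 2), ∑' k : ℤ, g (x + k) = ∫⁻ x, g x := by
  have hgk : ∀ k : ℤ, Measurable fun x : ℝ => g (x + k) := fun k =>
    hg.comp (measurable_id.add_const _)
  rw [lintegral_tsum fun k => (hgk k).aemeasurable]
  have h1 := lintegral_iUnion (μ := volume) (s := fun n : ℤ => Ico (-(1 / 2) + (n : ℝ)) (-(1 / 2) + n + 1))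
    (fun _ => measurableSet_Ico) (Set.pairwise_disjoint_Ico_add_intCast _) g
  rw [iUnion_Ico_add_intCast, setLIntegral_univ] at h1
  rw [h1]
  refine tsum_congr fun k => ?_
  rw [← lintegral_indicator measurableSet_Ico, ← lintegral_indicator measurableSet_Ico,
    ← lintegral_add_right_eq_self
      ((Ico (-(1 / 2) + (k : ℝ)) (-(1 / 2) + k + 1)).indicator g) (k : ℝ)]
  refine lintegral_congr fun x => ?_
  by_cases hx : x ∈ Ico (-(1 / 2) : ℝ) (1 / 2)
  · rw [indicator_of_mem hx, indicator_of_mem]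
    rw [mem_Ico] at hx ⊢
    constructor <;> linarith [hx.1, hx.2]
  · rw [indicator_of_notMem hx, indicator_of_notMem]
    intro h
    apply hx
    rw [mem_Ico] at h ⊢
    constructor <;> linarith [h.1, h.2]

theorem measurable_horoball (n : ℕ) (d : ℤ) : Measurable (Function.uncurry (horoball n d)) := by
  unfold horoball Function.uncurry
  refine Measurable.ite ?_ measurable_const measurable_const
  by_cases h : IsCoprime (n : ℤ) d
  · simp only [h, true_and]
    exact measurableSet_lt (by fun_prop) (by fun_prop)
  · simp [h]

theorem volume_disc_slice {n : ℕ} (hn : 0 < n) (d : ℤ) (y : ℝ) :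
    (volume : Measure ℝ) {x | (n * x + d) ^ 2 + (n * y) ^ 2 < y} =
      ENNReal.ofReal (2 * Real.sqrt (y - (n * y) ^ 2) / n) := by
  have hn0 : (0 : ℝ) < n := by exact_mod_cast hn
  have : {x : ℝ | (n * x + d) ^ 2 + (n * y) ^ 2 < y} =
      Ioo ((-Real.sqrt (y - (n * y) ^ 2) - d) / n) ((Real.sqrt (y - (n * y) ^ 2) - d) / n) := by
    ext x
    rw [mem_Ioo, div_lt_iff₀ hn0, lt_div_iff₀ hn0]
    have h1 : (n * x + d) ^ 2 + (n * y) ^ 2 < y ↔ |n * x + d| < Real.sqrt (y - (n * y) ^ 2) := by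
      rw [Real.lt_sqrt (abs_nonneg _), sq_abs, lt_sub_iff_add_lt]
    refine h1.trans ?_
    rw [abs_lt]
    constructor <;> rintro ⟨h1, h2⟩ <;> constructor <;> linarith
  rw [this, Real.volume_Ioo]
  congr 1
  ring

/-- Writing d = kn + r turns the sum over k into integer translates, which unfold the interval to
the whole line. Each of the φ(n) residues r prime to n then contributes one full chord. -/
theorem lintegral_horoball {n : ℕ} (hn : 0 < n) (y : ℝ) :
    ∫⁻ x in Ico (-(1 / 2) : ℝ) (1 / 2), ∑' d : ℤ, horoball n d x y =
      n.totient * ENNReal.ofReal (2 * Real.sqrt (y - (n * y) ^ 2) / n) := by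
  have : NeZero n := ⟨hn.ne'⟩
  have hn0 : (0 : ℝ) < n := by exact_mod_cast hn
  have hshift : ∀ (k : ℤ) (r : Fin n) (x : ℝ),
      horoball n (k * n + (r : ℕ)) x y = horoball n (r : ℕ) (x + k) y := by
    intro k r x
    unfold horoball
    have h1 : IsCoprime (n : ℤ) (k * n + (r : ℕ)) ↔ IsCoprime (n : ℤ) ((r : ℕ) : ℤ) := by
      rw [add_comm]
      exact IsCoprime.add_mul_right_right_iff
    have h2 : (n : ℝ) * x + ((k * n + (r : ℕ) : ℤ) : ℝ) = n * (x + k) + (((r : ℕ) : ℤ) : ℝ) := by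
      push_cast
      ring
    simp only [h1, h2]
  have hmeas : ∀ d : ℤ, Measurable fun x => horoball n d x y := fun d =>
    (measurable_horoball n d).comp (measurable_id.prodMk measurable_const)
  have hsum : ∀ x : ℝ, ∑' d : ℤ, horoball n d x y =
      ∑ r : Fin n, ∑' k : ℤ, horoball n (r : ℕ) (x + k) y := by
    intro x
    rw [← (Int.divModEquiv n).symm.tsum_eq, ENNReal.tsum_prod', ENNReal.tsum_comm, tsum_fintype]
    refine Finset.sum_congr rfl fun r _ => tsum_congr fun k => ?_
    rw [← hshift]
    rfl
  simp_rw [hsum]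
  have hmeas' : ∀ (d k : ℤ), Measurable fun x : ℝ => horoball n d (x + k) y := fun d k =>
    (hmeas d).comp (measurable_id.add_const (k : ℝ))
  rw [lintegral_finsetSum _ fun r _ => Measurable.tsum fun k : ℤ => hmeas' _ k]
  simp_rw [lintegral_Ico_tsum_int (hmeas _)]
  have hone : ∀ r : ℕ, ∫⁻ x, horoball n r x y = if n.Coprime r then
      ENNReal.ofReal (2 * Real.sqrt (y - (n * y) ^ 2) / n) else 0 := by
    intro r
    by_cases hr : n.Coprime r
    · rw [if_pos hr, ← volume_disc_slice hn r, ← lintegral_indicator_one]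
      · refine lintegral_congr fun x => ?_
        simp only [horoball, Nat.isCoprime_iff_coprime.2 hr, true_and, indicator, mem_ofPred_eq,
          Pi.one_apply]
      · exact measurableSet_lt (by fun_prop) (by fun_prop)
    · rw [if_neg hr]
      refine (lintegral_congr fun x => ?_).trans lintegral_zero
      rw [horoball, if_neg]
      exact fun h => hr (Nat.isCoprime_iff_coprime.1 h.1)
  simp_rw [hone]
  rw [Fin.sum_univ_eq_sum_range (fun r => if n.Coprime r then
      ENNReal.ofReal (2 * Real.sqrt (y - (n * y) ^ 2) / n) else 0) n, ← Finset.sum_filter,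
    Finset.sum_const, nsmul_eq_mul, Nat.totient_eq_card_coprime]

open ProbabilityTheory

/-! ### Dirichlet series with values in `[0, ∞]` -/

/-- Dirichlet convolution: the sum of φ over the divisors of n is n. -/
theorem tsum_mul_tsum_totient (s : ℝ) :
    (∑' k : ℕ, ENNReal.ofReal (((k + 1 : ℕ) : ℝ) ^ (-s))) *
        ∑' k : ℕ, ((k + 1).totient : ℝ≥0∞) * ENNReal.ofReal (((k + 1 : ℕ) : ℝ) ^ (-s)) =
      ∑' k : ℕ, ENNReal.ofReal (((k + 1 : ℕ) : ℝ) ^ (-(s - 1))) := by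
  rw [← tsum_pnat_eq_tsum_succ (f := fun k : ℕ => ENNReal.ofReal ((k : ℝ) ^ (-s))),
    ← tsum_pnat_eq_tsum_succ (f := fun k : ℕ =>
      (k.totient : ℝ≥0∞) * ENNReal.ofReal ((k : ℝ) ^ (-s))),
    ← tsum_pnat_eq_tsum_succ (f := fun k : ℕ => ENNReal.ofReal ((k : ℝ) ^ (-(s - 1)))),
    ← ENNReal.tsum_mul_right]
  simp_rw [← ENNReal.tsum_mul_left]
  rw [← ENNReal.tsum_prod (f := fun a b : ℕ+ => ENNReal.ofReal (((a : ℕ) : ℝ) ^ (-s)) *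
    (((b : ℕ).totient : ℝ≥0∞) * ENNReal.ofReal (((b : ℕ) : ℝ) ^ (-s)))),
    ← sigmaAntidiagonalEquivProd.tsum_eq, ENNReal.tsum_sigma']
  refine tsum_congr fun n => ?_
  have hn : (0 : ℝ) < (n : ℕ) := by exact_mod_cast n.pos
  have h1 : ∀ x : ((n : ℕ).divisorsAntidiagonal),
      ENNReal.ofReal ((((sigmaAntidiagonalEquivProd ⟨n, x⟩).1 : ℕ) : ℝ) ^ (-s)) *
        ((((sigmaAntidiagonalEquivProd ⟨n, x⟩).2 : ℕ).totient : ℝ≥0∞) *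
          ENNReal.ofReal ((((sigmaAntidiagonalEquivProd ⟨n, x⟩).2 : ℕ) : ℝ) ^ (-s))) =
      (x.1.2.totient : ℝ≥0∞) * ENNReal.ofReal (((n : ℕ) : ℝ) ^ (-s)) := by
    rintro ⟨⟨a, b⟩, hab⟩
    have hab' : a * b = n := (Nat.mem_divisorsAntidiagonal.1 hab).1
    change ENNReal.ofReal ((a : ℝ) ^ (-s)) * ((b.totient : ℝ≥0∞) * ENNReal.ofReal ((b : ℝ) ^ (-s)))
      = (b.totient : ℝ≥0∞) * ENNReal.ofReal (((n : ℕ) : ℝ) ^ (-s))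
    rw [← hab', Nat.cast_mul, Real.mul_rpow (by positivity) (by positivity),
      ENNReal.ofReal_mul (by positivity)]
    ring
  rw [tsum_congr h1, ENNReal.tsum_mul_right, tsum_fintype,
    Finset.sum_coe_sort (n : ℕ).divisorsAntidiagonal fun x => (x.2.totient : ℝ≥0∞),
    Nat.sum_divisorsAntidiagonal' (fun _ b => (b.totient : ℝ≥0∞)), ← Nat.cast_sum,
    Nat.sum_totient, ← ENNReal.ofReal_natCast, ← ENNReal.ofReal_mul (by positivity), neg_sub,
    sub_eq_add_neg, Real.rpow_add hn, Real.rpow_one]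

theorem tsum_ofReal_rpow_eq_riemannZeta {w : ℝ} (hw : 1 < w) :
    ∃ z : ℝ, 0 ≤ z ∧ (z : ℂ) = riemannZeta w ∧
      ∑' k : ℕ, ENNReal.ofReal (((k + 1 : ℕ) : ℝ) ^ (-w)) = ENNReal.ofReal z := by
  have hs : Summable fun k : ℕ => ((k + 1 : ℕ) : ℝ) ^ (-w) :=
    (summable_nat_add_iff 1).2 (Real.summable_nat_rpow.2 (by linarith))
  refine ⟨∑' k : ℕ, ((k + 1 : ℕ) : ℝ) ^ (-w), tsum_nonneg fun k => by positivity, ?_,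
    (ENNReal.ofReal_tsum_of_nonneg (fun k => by positivity) hs).symm⟩
  rw [zeta_eq_tsum_one_div_nat_add_one_cpow (by simpa using hw), Complex.ofReal_tsum]
  refine tsum_congr fun k => ?_
  rw [Complex.ofReal_cpow (by positivity), one_div, Complex.ofReal_neg, Complex.cpow_neg]
  push_cast
  rfl

/-! ### The area of the cusp regions -/

theorem lintegral_betaPDF_mul_left {α β a : ℝ} (hα : 0 < α) (hβ : 0 < β) (ha : 0 < a) :
    ∫⁻ y in Ioi (0 : ℝ), betaPDF α β (a * y) = ENNReal.ofReal a⁻¹ := by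
  have hm : Measurable (betaPDF α β) := (measurable_betaPDFReal α β).ennreal_ofReal
  rw [← lintegral_indicator measurableSet_Ioi]
  have h1 : ∀ y : ℝ, (Ioi (0 : ℝ)).indicator (fun y => betaPDF α β (a * y)) y =
      betaPDF α β (a * y) := by
    intro y
    by_cases hy : y ∈ Ioi (0 : ℝ)
    · rw [indicator_of_mem hy]
    · rw [indicator_of_notMem hy, betaPDF_eq_zero_of_nonpos]
      exact mul_nonpos_of_nonneg_of_nonpos ha.le (not_lt.1 hy)
  rw [lintegral_congr h1, ← lintegral_map hm (measurable_const_mul a),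
    Real.map_volume_mul_left ha.ne', lintegral_smul_measure, lintegral_betaPDF_eq_one hα hβ,
    abs_of_pos (inv_pos.2 ha), smul_eq_mul, mul_one]

/-- In the variable n²y the chord length times y^{σ-2} is a multiple of the beta density with
parameters σ - 1/2 and 3/2, whose total mass is one. -/
theorem lintegral_rpow_mul_horoball {σ : ℝ} (hσ : 1 < σ) {n : ℕ} (hn : 0 < n) :
    ∫⁻ y in Ioi (0 : ℝ), ENNReal.ofReal (y ^ (σ - 2)) *
        ∫⁻ x in Ico (-(1 / 2) : ℝ) (1 / 2), ∑' d : ℤ, horoball n d x y =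
      n.totient * ENNReal.ofReal ((n : ℝ) ^ (-(2 * σ))) *
        ENNReal.ofReal (2 * beta (σ - 1 / 2) (3 / 2)) := by
  have hn0 : (0 : ℝ) < n := by exact_mod_cast hn
  have hα : 0 < σ - 1 / 2 := by linarith
  have hb := beta_pos hα (by norm_num : (0 : ℝ) < 3 / 2)
  have key : ∀ y ∈ Ioi (0 : ℝ), ENNReal.ofReal (y ^ (σ - 2)) *
      ∫⁻ x in Ico (-(1 / 2) : ℝ) (1 / 2), ∑' d : ℤ, horoball n d x y =
      n.totient * ENNReal.ofReal ((n : ℝ) ^ (2 - 2 * σ)) *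
        ENNReal.ofReal (2 * beta (σ - 1 / 2) (3 / 2)) *
          betaPDF (σ - 1 / 2) (3 / 2) ((n : ℝ) ^ 2 * y) := by
    intro y hy
    have hy0 : (0 : ℝ) < y := hy
    have hv : 0 < (n : ℝ) ^ 2 * y := by positivity
    rw [lintegral_horoball hn, mul_left_comm, mul_assoc, mul_assoc]
    congr 1
    rw [← ENNReal.ofReal_mul (by positivity)]
    by_cases h : (n : ℝ) ^ 2 * y < 1
    · rw [betaPDF_of_pos_lt_one hv h, ← ENNReal.ofReal_mul (by positivity),
        ← ENNReal.ofReal_mul (by positivity)]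
      congr 1
      have h1 : y - (n * y) ^ 2 = y * (1 - n ^ 2 * y) := by ring
      have h2 : ((n : ℝ) ^ 2 * y) ^ (σ - 1 / 2 - 1) =
          (n : ℝ) ^ (2 * σ - 3) * y ^ (σ - 3 / 2) := by
        rw [Real.mul_rpow (by positivity) hy0.le, ← Real.rpow_natCast, ← Real.rpow_mul hn0.le]
        congr 2 <;> push_cast <;> ring
      have h3 : (n : ℝ) ^ (2 - 2 * σ) * (n : ℝ) ^ (2 * σ - 3) = (n : ℝ)⁻¹ := by
        rw [← Real.rpow_add hn0, ← Real.rpow_neg_one]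
        congr 1
        ring
      have h4 : y ^ (σ - 2) * y ^ (1 / 2 : ℝ) = y ^ (σ - 3 / 2) := by
        rw [← Real.rpow_add hy0]
        congr 1
        ring
      have h5 : (3 / 2 - 1 : ℝ) = 1 / 2 := by norm_num
      rw [h1, Real.sqrt_eq_rpow, Real.mul_rpow hy0.le (by linarith), h2, h5, ← h4, ← mul_assoc]
      calc _ = (y ^ (σ - 2) * y ^ (1 / 2 : ℝ)) * (1 - n ^ 2 * y) ^ (1 / 2 : ℝ) * 2 * (n : ℝ)⁻¹ := by
            ring
        _ = _ := by
            rw [← h3]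
            have hb' := hb.ne'
            generalize beta (σ - 1 / 2) (3 / 2) = b at hb' ⊢
            field_simp
    -- Above the disc the radicand is nonpositive, where the real square root is 0, and the beta
    -- density vanishes too.
    · rw [betaPDF_eq_zero_of_one_le (not_lt.1 h), mul_zero, mul_zero, Real.sqrt_eq_zero_of_nonpos]
      · simp
      · nlinarith [not_lt.1 h]
  rw [setLIntegral_congr_fun measurableSet_Ioi key, lintegral_const_mul,
    lintegral_betaPDF_mul_left hα (by norm_num) (by positivity), mul_right_comm,
    mul_assoc _ _ (ENNReal.ofReal ((n ^ 2)⁻¹)),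
    ← ENNReal.ofReal_mul (by positivity)]
  · congr 3
    rw [← Real.rpow_natCast, ← Real.rpow_neg hn0.le, ← Real.rpow_add hn0]
    congr 1
    push_cast
    ring
  · exact (measurable_betaPDFReal _ _).ennreal_ofReal.comp (measurable_const_mul _)

theorem lintegral_strip_im_le_one {σ : ℝ} (hσ : 1 < σ) :
    ∫⁻ τ in strip, ENNReal.ofReal (τ.im ^ σ) * {τ : ℍ | τ.im ≤ 1}.indicator 1 τ =
      ENNReal.ofReal (1 / (σ - 1)) := by
  have hm : Measurable (Function.uncurry fun _ y : ℝ => (Iic (1 : ℝ)).indicator (1 : ℝ → ℝ≥0∞) y) :=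
    (measurable_one.indicator measurableSet_Iic).comp measurable_snd
  refine (lintegral_strip hm σ).trans ?_
  have h1 : ∀ y : ℝ, ENNReal.ofReal (y ^ (σ - 2)) * ∫⁻ _ in Ico (-(1 / 2) : ℝ) (1 / 2),
      (Iic (1 : ℝ)).indicator (1 : ℝ → ℝ≥0∞) y =
      (Iic (1 : ℝ)).indicator (fun y => ENNReal.ofReal (y ^ (σ - 2))) y := by
    intro y
    rw [lintegral_const, Measure.restrict_apply_univ, Real.volume_Ico]
    by_cases hy : y ∈ Iic (1 : ℝ)
    · rw [indicator_of_mem hy, indicator_of_mem hy]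
      norm_num
    · rw [indicator_of_notMem hy, indicator_of_notMem hy]
      simp
  rw [lintegral_congr h1, setLIntegral_indicator measurableSet_Iic, Iic_inter_Ioi,
    ← ofReal_integral_eq_lintegral_ofReal, ← intervalIntegral.integral_of_le zero_le_one,
    integral_rpow (Or.inl (by linarith)), Real.one_rpow, Real.zero_rpow (by linarith)]
  · congr 1
    ring
  · exact (intervalIntegrable_iff_integrableOn_Ioc_of_le zero_le_one).1
      (intervalIntegral.intervalIntegrable_rpow' (by linarith))
  · exact (ae_restrict_iff' measurableSet_Ioc).2 (ae_of_all _ fun y hy =>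
      Real.rpow_nonneg hy.1.le _)

theorem lintegral_strip_semistableSet_add {σ : ℝ} (hσ : 1 < σ) :
    (∫⁻ τ in strip ∩ semistableSet, ENNReal.ofReal (τ.im ^ σ)) +
        (∑' k : ℕ, ((k + 1).totient : ℝ≥0∞) * ENNReal.ofReal (((k + 1 : ℕ) : ℝ) ^ (-(2 * σ)))) *
          ENNReal.ofReal (2 * beta (σ - 1 / 2) (3 / 2)) =
      ENNReal.ofReal (1 / (σ - 1)) := by
  have him : Measurable fun τ : ℍ => ENNReal.ofReal (τ.im ^ σ) := by
    have : Measurable fun τ : ℍ => τ.im := UpperHalfPlane.continuous_im.measurable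
    fun_prop
  have hH : ∀ n : ℕ, Measurable (Function.uncurry fun x y => ∑' d : ℤ, horoball n d x y) :=
    fun n => Measurable.tsum fun d => measurable_horoball n d
  have hH' : ∀ n : ℕ, Measurable fun τ : ℍ =>
      ENNReal.ofReal (τ.im ^ σ) * ∑' d : ℤ, horoball n d τ.re τ.im := fun n =>
    him.mul ((hH n).comp (UpperHalfPlane.continuous_re.measurable.prodMk
      UpperHalfPlane.continuous_im.measurable))
  have h1 : ∀ τ : ℍ, ENNReal.ofReal (τ.im ^ σ) * {τ : ℍ | τ.im ≤ 1}.indicator 1 τ =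
      semistableSet.indicator (fun τ => ENNReal.ofReal (τ.im ^ σ)) τ +
        ∑' n : ℕ, ENNReal.ofReal (τ.im ^ σ) * ∑' d : ℤ, horoball (n + 1) d τ.re τ.im := by
    intro τ
    rw [indicator_im_le_one, mul_add, ENNReal.tsum_mul_left,
      ENNReal.tsum_prod (f := fun (n : ℕ) (d : ℤ) => horoball (n + 1) d τ.re τ.im)]
    congr 1
    by_cases h : τ ∈ semistableSet
    · rw [indicator_of_mem h, indicator_of_mem h, Pi.one_apply, mul_one]
    · rw [indicator_of_notMem h, indicator_of_notMem h, mul_zero]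
  have h2 : ∫⁻ τ in strip, ∑' n : ℕ, ENNReal.ofReal (τ.im ^ σ) *
      ∑' d : ℤ, horoball (n + 1) d τ.re τ.im =
      (∑' k : ℕ, ((k + 1).totient : ℝ≥0∞) * ENNReal.ofReal (((k + 1 : ℕ) : ℝ) ^ (-(2 * σ)))) *
        ENNReal.ofReal (2 * beta (σ - 1 / 2) (3 / 2)) := by
    rw [← ENNReal.tsum_mul_right]
    refine (lintegral_tsum fun n => (hH' (n + 1)).aemeasurable).trans (tsum_congr fun n => ?_)
    exact (lintegral_strip (hH (n + 1)) σ).trans (lintegral_rpow_mul_horoball hσ n.succ_pos)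
  have h3 : ∫⁻ τ in strip, semistableSet.indicator (fun τ => ENNReal.ofReal (τ.im ^ σ)) τ =
      ∫⁻ τ in strip ∩ semistableSet, ENNReal.ofReal (τ.im ^ σ) := by
    rw [setLIntegral_indicator measurableSet_semistableSet, inter_comm]
  rw [← h2, ← h3, ← lintegral_add_left (him.indicator measurableSet_semistableSet),
    ← lintegral_strip_im_le_one hσ]
  exact lintegral_congr fun τ => (h1 τ).symm

/-! ### The moduli integral at real points -/

theorem lintegral_isSemistable {σ : ℝ} (hσ : 1 < σ) : ∃ c : ℝ, 0 ≤ c ∧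
    (c : ℂ) = 2 * completedRiemannZeta (2 * σ) / (σ - 1) - 2 * completedRiemannZeta (2 * σ - 1) / σ ∧
    ∫⁻ Λ in {Λ : Moduli | Λ.IsSemistable},
      ENNReal.ofReal (Real.exp Λ.h0 - 1) * ENNReal.ofReal (Real.exp (σ * Real.log Λ.vol))
        ∂Moduli.measure = ENNReal.ofReal c := by
  have hσ0 : 0 < σ := by linarith
  obtain ⟨z, hz0, hz, hzs⟩ := tsum_ofReal_rpow_eq_riemannZeta (w := 2 * σ) (by linarith)
  obtain ⟨z', hz0', hz', hzs'⟩ := tsum_ofReal_rpow_eq_riemannZeta (w := 2 * σ - 1) (by linarith)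
  have hb := beta_pos (by linarith : 0 < σ - 1 / 2) (by norm_num : (0 : ℝ) < 3 / 2)
  have hΓ := Real.Gamma_pos_of_pos hσ0
  have hadd := lintegral_strip_semistableSet_add hσ
  have hprod := tsum_mul_tsum_totient (2 * σ)
  rw [hzs, hzs'] at hprod
  set J := ∫⁻ τ in strip ∩ semistableSet, ENNReal.ofReal (τ.im ^ σ)
  -- Finiteness allows the passage from [0, ∞] to real numbers, where the disc term can be
  -- subtracted.
  have hJ : J ≠ ∞ := ne_top_of_le_ne_top ENNReal.ofReal_ne_top (le_self_add.trans_eq hadd)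
  have hreal : z * J.toReal = z / (σ - 1) - z' * (2 * beta (σ - 1 / 2) (3 / 2)) := by
    have h := congrArg (fun t => ENNReal.ofReal z * t) hadd
    simp only [mul_add, ← mul_assoc, hprod] at h
    rw [← ENNReal.ofReal_toReal hJ, ← ENNReal.ofReal_mul hz0, ← ENNReal.ofReal_mul hz0',
      ← ENNReal.ofReal_mul hz0, ← ENNReal.ofReal_add (by positivity) (by positivity),
      ENNReal.ofReal_eq_ofReal_iff (by positivity)
        (mul_nonneg hz0 (one_div_nonneg.2 (by linarith)))] at h
    rw [eq_sub_iff_add_eq, h, mul_one_div]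
  refine ⟨2 * (Real.pi ^ (-σ) * Real.Gamma σ) * (z * J.toReal), by positivity, ?_, ?_⟩
  · rw [hreal]
    have hG : Real.Gamma (σ + 1) = σ * Real.Gamma σ := Real.Gamma_add_one hσ0.ne'
    have hG' : Real.Gamma (3 / 2) = 1 / 2 * Real.sqrt Real.pi := by
      rw [← Real.Gamma_one_half_eq, ← Real.Gamma_add_one (by norm_num)]
      norm_num
    have hpow : Real.pi ^ (-((2 * σ - 1) / 2)) = Real.pi ^ (-σ) * Real.sqrt Real.pi := by
      rw [Real.sqrt_eq_rpow, ← Real.rpow_add Real.pi_pos]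
      congr 1
      ring
    -- The values Γ(σ+1) = σΓ(σ) and Γ(3/2) = √π/2 turn the disc term into the Gamma factor of
    -- Λ(2σ-1), divided by σ.
    have hbeta : Real.pi ^ (-σ) * Real.Gamma σ * (2 * beta (σ - 1 / 2) (3 / 2)) =
        Real.pi ^ (-((2 * σ - 1) / 2)) * Real.Gamma ((2 * σ - 1) / 2) / σ := by
      rw [beta, show σ - 1 / 2 + 3 / 2 = σ + 1 by ring, hG, hG', hpow,
        show σ - 1 / 2 = (2 * σ - 1) / 2 by ring]
      field_simp
    have hΛ : ∀ {w ζ : ℝ}, 1 < w → (ζ : ℂ) = riemannZeta w →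
        completedRiemannZeta w = ((Real.pi ^ (-(w / 2)) * Real.Gamma (w / 2) * ζ : ℝ) : ℂ) := by
      intro w ζ hw hζ
      rw [completedRiemannZeta_eq_Gammaℝ_mul (by rw [Complex.ofReal_re]; linarith), ← hζ,
        Complex.Gammaℝ_def]
      push_cast [Complex.ofReal_cpow Real.pi_pos.le, Complex.Gamma_ofReal]
      rw [neg_div, ← Complex.Gamma_ofReal]
      push_cast
      rfl
    have h1 := hΛ (by linarith) hz
    have h2 := hΛ (by linarith) hz'
    rw [mul_div_cancel_left₀ _ (two_ne_zero' ℝ)] at h1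
    have e1 : ((2 * σ : ℝ) : ℂ) = 2 * σ := by push_cast; rfl
    have e2 : ((2 * σ - 1 : ℝ) : ℂ) = 2 * σ - 1 := by push_cast; rfl
    rw [e1] at h1
    rw [e2] at h2
    rw [h1, h2]
    exact_mod_cast (show 2 * (Real.pi ^ (-σ) * Real.Gamma σ) *
        (z / (σ - 1) - z' * (2 * beta (σ - 1 / 2) (3 / 2))) =
      2 * (Real.pi ^ (-σ) * Real.Gamma σ * z) / (σ - 1) -
        2 * (Real.pi ^ (-((2 * σ - 1) / 2)) * Real.Gamma ((2 * σ - 1) / 2) * z') / σ by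
      linear_combination (-2 * z') * hbeta)
  · rw [lintegral_isSemistable_eq_epstein hσ0]
    simp_rw [tsum_quadForm_rpow, hzs]
    rw [lintegral_const_mul' _ _ ENNReal.ofReal_ne_top, lintegral_fd_tsum_coprime]
    change _ * (_ * (2 * J)) = _
    have hp : 0 ≤ Real.pi ^ (-σ) * Real.Gamma σ := by positivity
    generalize Real.pi ^ (-σ) * Real.Gamma σ = p at hp ⊢
    rw [mul_assoc 2 p, mul_left_comm 2 p, mul_left_comm 2 z, ENNReal.ofReal_mul hp,
      ENNReal.ofReal_mul hz0, ENNReal.ofReal_mul zero_le_two, ENNReal.ofReal_toReal hJ,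
      ENNReal.ofReal_ofNat]

/-! ### Convergence, meromorphic continuation and zeros -/

/-- The measure on the moduli space of semistable lattices weighted by `e^{h⁰} - 1`. -/
noncomputable def weightedMeasure : Measure Moduli :=
  (Moduli.measure.restrict {Λ : Moduli | Λ.IsSemistable}).withDensity
    fun Λ => ENNReal.ofReal (Real.exp Λ.h0 - 1)

theorem measurable_weight : Measurable fun Λ : Moduli => ENNReal.ofReal (Real.exp Λ.h0 - 1) :=
  ((Real.measurable_exp.comp Moduli.measurable_h0).sub_const 1).ennreal_ofReal

theorem measurable_log_vol : Measurable fun Λ : Moduli => Real.log Λ.vol :=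
  Real.measurable_log.comp Moduli.measurable_vol

theorem lintegral_exp_weightedMeasure (σ : ℝ) :
    ∫⁻ Λ, ENNReal.ofReal (Real.exp (σ * Real.log Λ.vol)) ∂weightedMeasure =
      ∫⁻ Λ in {Λ : Moduli | Λ.IsSemistable},
        ENNReal.ofReal (Real.exp Λ.h0 - 1) * ENNReal.ofReal (Real.exp (σ * Real.log Λ.vol))
          ∂Moduli.measure := by
  rw [weightedMeasure, lintegral_withDensity_eq_lintegral_mul _ measurable_weight]
  · rfl
  · exact (Real.measurable_exp.comp (measurable_log_vol.const_mul σ)).ennreal_ofReal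

theorem integrable_exp_weightedMeasure {σ : ℝ} (hσ : 1 < σ) :
    Integrable (fun Λ : Moduli => Real.exp (σ * Real.log Λ.vol)) weightedMeasure := by
  refine ⟨(Real.measurable_exp.comp (measurable_log_vol.const_mul σ)).aestronglyMeasurable, ?_⟩
  rw [hasFiniteIntegral_iff_ofReal (ae_of_all _ fun _ => (Real.exp_pos _).le),
    lintegral_exp_weightedMeasure]
  obtain ⟨c, -, -, h⟩ := lintegral_isSemistable hσ
  rw [h]
  exact ENNReal.ofReal_lt_top

theorem Ioi_subset_integrableExpSet :
    Ioi (1 : ℝ) ⊆ interior (ProbabilityTheory.integrableExpSet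
      (fun Λ : Moduli => Real.log Λ.vol) weightedMeasure) :=
  isOpen_Ioi.subset_interior_iff.2 fun _ hσ => integrable_exp_weightedMeasure hσ

theorem integrand_eq_smul (s : ℂ) (Λ : Moduli) :
    integrand s Λ = (ENNReal.ofReal (Real.exp Λ.h0 - 1)).toReal •
      Complex.exp (s * (Real.log Λ.vol : ℂ)) := by
  rw [ENNReal.toReal_ofReal (by linarith [Real.one_le_exp Λ.h0_nonneg]), Complex.real_smul]
  rfl

theorem integrableOn_integrand {s : ℂ} (hs : 1 < s.re) :
    IntegrableOn (integrand s) {Λ : Moduli | Λ.IsSemistable} Moduli.measure := by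
  have h : Integrable (fun Λ : Moduli => Complex.exp (s * (Real.log Λ.vol : ℂ)))
      weightedMeasure := by
    refine (integrable_exp_weightedMeasure hs).mono' ?_ (ae_of_all _ fun Λ => ?_)
    · exact (Complex.measurable_exp.comp ((Complex.measurable_ofReal.comp
        measurable_log_vol).const_mul s)).aestronglyMeasurable
    · rw [Complex.norm_exp, Complex.re_mul_ofReal]
  rw [weightedMeasure, integrable_withDensity_iff_integrable_smul' measurable_weight
    (ae_of_all _ fun _ => ENNReal.ofReal_lt_top)] at h
  simp_rw [← integrand_eq_smul] at h
  exact h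

/-- As a moment generating function of log Vol, the integral is analytic in s wherever the real
exponential moments are finite in a neighbourhood of Re s. -/
theorem rankTwoZetaIntegral_eq_complexMGF (s : ℂ) :
    rankTwoZetaIntegral s =
      ProbabilityTheory.complexMGF (fun Λ : Moduli => Real.log Λ.vol) weightedMeasure s := by
  rw [ProbabilityTheory.complexMGF, weightedMeasure,
    integral_withDensity_eq_integral_toReal_smul measurable_weight
      (ae_of_all _ fun _ => ENNReal.ofReal_lt_top)]
  simp_rw [← integrand_eq_smul]
  rfl

/-- The meromorphic continuation of the rank two zeta function. -/
noncomputable def rankTwoZeta (s : ℂ) : ℂ :=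
  (xi (2 * s) - xi (2 * s - 1)) / (s * (s - 1) * (2 * s - 1))

theorem analyticAt_xi_sub_xi (s : ℂ) :
    AnalyticAt ℂ (fun s => xi (2 * s) - xi (2 * s - 1)) s := by
  have h := differentiable_xi
  have : Differentiable ℂ fun s => xi (2 * s) - xi (2 * s - 1) :=
    (h.comp (by fun_prop : Differentiable ℂ fun s : ℂ => 2 * s)).sub
      (h.comp (by fun_prop : Differentiable ℂ fun s : ℂ => 2 * s - 1))
  exact this.analyticAt s

theorem analyticAt_denominator (s : ℂ) :
    AnalyticAt ℂ (fun s : ℂ => s * (s - 1) * (2 * s - 1)) s := by fun_prop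

theorem meromorphic_rankTwoZeta : Meromorphic rankTwoZeta := fun s =>
  (analyticAt_xi_sub_xi s).meromorphicAt.div (analyticAt_denominator s).meromorphicAt

theorem rankTwoZetaIntegral_ofReal {σ : ℝ} (hσ : 1 < σ) :
    rankTwoZetaIntegral σ = rankTwoZeta σ := by
  obtain ⟨c, hc0, hc, h⟩ := lintegral_isSemistable hσ
  have hL : rankTwoZetaIntegral σ = c := by
    rw [rankTwoZetaIntegral_eq_complexMGF, ProbabilityTheory.complexMGF_ofReal,
      ProbabilityTheory.mgf, integral_eq_lintegral_of_nonneg_ae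
        (ae_of_all _ fun _ => (Real.exp_pos _).le)
        (integrable_exp_weightedMeasure hσ).aestronglyMeasurable,
      lintegral_exp_weightedMeasure, h, ENNReal.toReal_ofReal hc0]
  have h0 : (σ : ℂ) ≠ 0 := by exact_mod_cast (by linarith : σ ≠ 0)
  have h1 : (σ : ℂ) - 1 ≠ 0 := by exact_mod_cast (by linarith : σ - 1 ≠ 0)
  have h2 : (2 * σ : ℂ) - 1 ≠ 0 := by exact_mod_cast (by linarith : 2 * σ - 1 ≠ 0)
  have h3 : (2 * σ : ℂ) - 1 ≠ 1 := by exact_mod_cast (by linarith : 2 * σ - 1 ≠ 1)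
  rw [hL, hc, rankTwoZeta, xi_eq (mul_ne_zero two_ne_zero h0) (sub_ne_zero.1 h2), xi_eq h2 h3]
  field_simp
  ring

theorem rankTwoZetaIntegral_eq {s : ℂ} (hs : 1 < s.re) :
    rankTwoZetaIntegral s = rankTwoZeta s := by
  have hopen : IsOpen {s : ℂ | 1 < s.re} := isOpen_lt continuous_const Complex.continuous_re
  have hf : AnalyticOnNhd ℂ rankTwoZetaIntegral {s : ℂ | 1 < s.re} := by
    rw [funext rankTwoZetaIntegral_eq_complexMGF]
    exact fun s hs => ProbabilityTheory.analyticAt_complexMGF (Ioi_subset_integrableExpSet hs)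
  have hg : AnalyticOnNhd ℂ rankTwoZeta {s : ℂ | 1 < s.re} := by
    intro s hs
    refine (analyticAt_xi_sub_xi s).div (analyticAt_denominator s) ?_
    replace hs : 1 < s.re := hs
    refine mul_ne_zero (mul_ne_zero ?_ ?_) ?_
    · rintro rfl; norm_num at hs
    · intro h; have := congrArg Complex.re h; simp at this; linarith
    · intro h; have := congrArg Complex.re h; simp at this; linarith
  refine hf.eqOn_of_preconnected_of_frequently_eq hg (convex_halfSpace_re_gt 1).isPreconnected
    (by simp : (2 : ℂ) ∈ {s : ℂ | 1 < s.re}) ?_ hs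
  -- The real points to the right of 2 accumulate at 2, which suffices for the identity theorem.
  have ht : Tendsto (fun x : ℝ => (x : ℂ)) (𝓝[>] 2) (𝓝[≠] 2) := by
    refine tendsto_nhdsWithin_iff.2 ⟨?_, ?_⟩
    · exact (Complex.continuous_ofReal.tendsto' 2 2 (by simp)).mono_left nhdsWithin_le_nhds
    · filter_upwards [self_mem_nhdsWithin] with x hx
      have h : x ≠ 2 := ne_of_gt hx
      simpa using (by exact_mod_cast h : (x : ℂ) ≠ 2)
  refine ht.frequently (Eventually.frequently ?_)
  filter_upwards [self_mem_nhdsWithin] with x hx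
  exact rankTwoZetaIntegral_ofReal (one_lt_two.trans hx)

theorem isRankTwoZeta_rankTwoZeta : IsRankTwoZeta rankTwoZeta :=
  ⟨meromorphic_rankTwoZeta, fun _ hs => (rankTwoZetaIntegral_eq hs).symm⟩

/-- A meromorphic continuation may take arbitrary values on a discrete set, so uniqueness is stated
on punctured neighbourhoods. The difference has infinite order at 2, hence everywhere by
connectedness. -/
theorem IsRankTwoZeta.eventuallyEq {ξ : ℂ → ℂ} (h : IsRankTwoZeta ξ) (s : ℂ) :
    ξ =ᶠ[𝓝[≠] s] rankTwoZeta := by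
  have hD : Meromorphic (ξ - rankTwoZeta) := fun s =>
    (h.meromorphic s).sub (meromorphic_rankTwoZeta s)
  have h2 : meromorphicOrderAt (ξ - rankTwoZeta) 2 = ⊤ := by
    rw [meromorphicOrderAt_eq_top_iff]
    refine eventually_nhdsWithin_of_eventually_nhds ?_
    filter_upwards [(isOpen_lt continuous_const Complex.continuous_re).mem_nhds
      (by simp : (1 : ℝ) < (2 : ℂ).re)] with z hz
    rw [Pi.sub_apply, h.eq_integral z hz, rankTwoZetaIntegral_eq hz, sub_self]
  have hs : meromorphicOrderAt (ξ - rankTwoZeta) s = ⊤ := by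
    by_contra hne
    exact (MeromorphicOn.exists_meromorphicOrderAt_ne_top_iff_forall (U := univ)
      (fun z _ => hD z) isConnected_univ).1 ⟨⟨s, mem_univ s⟩, hne⟩ ⟨2, mem_univ _⟩ h2
  rw [meromorphicOrderAt_eq_top_iff] at hs
  filter_upwards [hs] with z hz
  exact sub_eq_zero.1 hz

/-- Multiplying the vanishing limit by the denominator, which has a finite limit at s, shows that
the continuous numerator vanishes at s. The points 0, 1/2 and 1 need no separate treatment. -/
theorem re_eq_one_half_of_order_pos {s : ℂ} (h : 0 < meromorphicOrderAt rankTwoZeta s) :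
    s.re = 1 / 2 := by
  apply re_eq_one_half_of_xi_eq
  have h1 := (tendsto_zero_iff_meromorphicOrderAt_pos (meromorphic_rankTwoZeta s)).2 h
  have h2 : Tendsto (fun s : ℂ => s * (s - 1) * (2 * s - 1)) (𝓝[≠] s)
      (𝓝 (s * (s - 1) * (2 * s - 1))) :=
    (analyticAt_denominator s).continuousAt.tendsto.mono_left nhdsWithin_le_nhds
  have h3 := h1.mul h2
  rw [zero_mul] at h3
  have h4 : Tendsto (fun s : ℂ => xi (2 * s) - xi (2 * s - 1)) (𝓝[≠] s) (𝓝 0) := by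
    refine h3.congr' ?_
    have hne : ∀ a : ℂ, ∀ᶠ z in 𝓝[≠] s, z ≠ a := fun a => by
      rcases eq_or_ne s a with rfl | hsa
      · exact self_mem_nhdsWithin
      · exact nhdsWithin_le_nhds (isOpen_ne.mem_nhds hsa)
    filter_upwards [hne 0, hne 1, hne (1 / 2)] with z z0 z1 z2
    refine div_mul_cancel₀ _ (mul_ne_zero (mul_ne_zero z0 (sub_ne_zero.2 z1)) ?_)
    intro h
    apply z2
    linear_combination h / 2
  have h5 := (analyticAt_xi_sub_xi s).continuousAt.tendsto.mono_left
    (nhdsWithin_le_nhds (s := {s}ᶜ))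
  exact sub_eq_zero.1 (tendsto_nhds_unique h5 h4)

end NonabelianZeta

theorem mainTheorem5 :
    (∀ s : ℂ, 1 < s.re →
      MeasureTheory.IntegrableOn (NonabelianZeta.integrand s)
        {Λ : NonabelianZeta.Moduli | Λ.IsSemistable} NonabelianZeta.Moduli.measure) ∧
    (∃ ξ : ℂ → ℂ, NonabelianZeta.IsRankTwoZeta ξ) ∧
    ∀ ξ : ℂ → ℂ, NonabelianZeta.IsRankTwoZeta ξ →
      ∀ s : ℂ, 0 < meromorphicOrderAt ξ s → s.re = 1 / 2 := by
  refine ⟨fun s hs => NonabelianZeta.integrableOn_integrand hs,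
    ⟨_, NonabelianZeta.isRankTwoZeta_rankTwoZeta⟩, fun ξ hξ s hs => ?_⟩
  rw [meromorphicOrderAt_congr (hξ.eventuallyEq s)] at hs
  exact NonabelianZeta.re_eq_one_half_of_order_pos hs
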